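/- Let $n\ge 0$, and let $\alpha_0,\dots,\alpha_{n-1}\in\mathbb D$ and $\tau_n\in\mathbb S^1$ be functions of a real variable $t$, where $\mathbb D$ is the open unit disk and $\mathbb S^1$ the unit circle. Let $\mathrm G=\mathrm G(\alpha_0,\dots,\alpha_{n-1},\tau_n):=\mathrm G_0\mathrm G_1\cdots \mathrm G_n$ be the unitary $(n+1)\times(n+1)$ upper Hessenberg matrix with positive subdiagonal given by $$\mathrm G_j:=\operatorname{diag}(\mathrm I_j,\Theta_j,\mathrm I_{n-j-1}),\quad \Theta_j:=\begin{pmatrix}\overline{\alpha_j}&\rho_j\\ \rho_j&-\alpha_j\end{pmatrix},\quad \rho_j:=(1-|\alpha_j|^2)^{1/2}\quad(0\le j\le n-1),\qquad \mathrm G_n:=\operatorname{diag}(\mathrm I_n,\overline{\tau_n}),$$ and suppose that $\mathrm G$ is a differentiable function of $t\in\mathbb R$. Let $\zeta\in\mathbb S^1$ be fixed, let $\zeta^{1/2}$ be either of its square roots, and let $p_0\in\mathbb R\setminus\{0\}$. For $z\in\mathbb C$ and each $t$ define $$\tau_n(\zeta):=\tau_n,\qquad \tau_j(\zeta):=\frac{\overline\zeta\,\alpha_j+\tau_{j+1}(\zeta)}{\overline{\alpha_j}\,\tau_{j+1}(\zeta)+\overline\zeta}\quad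 (j=n-1,\dots,0),$$ $$\beta_0(\zeta):=\frac1{\overline{\zeta^{1/2}}-\tau_0(\zeta)\,\zeta^{1/2}},\qquad \beta_j(\zeta):=\frac1{\beta_{j-1}(\zeta)}\;\frac1{\overline\zeta+\tau_{j-1}(\zeta)\,\overline{\alpha_{j-2}}}\;\frac1{1-\overline{\tau_{j-1}(\zeta)}\,\alpha_{j-1}}\quad (j=1,\dots,n),$$ with the convention $\alpha_{-1}:=-1$; the polynomials $$p_{-1}(z,\zeta):=0,\quad p_0(z,\zeta):=p_0,\quad p_{j+1}(z,\zeta):=\bigl(\beta_j(\zeta)+\overline{\beta_j(\zeta)}\,z\bigr)p_j(z,\zeta)-z\,p_{j-1}(z,\zeta)\quad (j=0,\dots,n);$$ and the lower bidiagonal matrix $$\mathrm A:=\zeta^{1/2}\begin{pmatrix}\overline{\beta_0(\zeta)}&&&\\-1&\overline{\beta_1(\zeta)}&&\\&\ddots&\ddots&\\&&-1&\overline{\beta_n(\zeta)}\end{pmatrix},\qquad \mathrm H:=\frac{\mathrm A+\mathrm A^*}2,\quad \mathrm K:=\frac{\mathrm A-\mathrm A^*}{2i},$$ so that $\mathrm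 A=\mathrm H+i\mathrm K$. Then, at every $t$ at which $\zeta$ is not an eigenvalue of $\mathrm G$: 1. $\mathrm H$ is positive definite. 2. The eigenvalues of $\mathrm G$ coincide, also with multiplicities, with the zeros of $p_{n+1}(\cdot,\zeta)$. 3. The matrix function $\mathrm H^{-1/2}\mathrm K\mathrm H^{-1/2}$ is differentiable at $t$. For each eigenvalue $\eta$ of $\mathrm G$ at $t$ there is a real function $\theta$, defined and continuous near $t$, such that $e^{i\theta(u)}$ is an eigenvalue of $\mathrm G$ at $u$ for all $u$ near $t$ and $e^{i\theta(t)}=\eta$. Every such $\theta$ is differentiable at $t$ and, writing $\frac{\mathrm d}{\mathrm dt}\arg\eta:=\theta'(t)$ and $\mathrm p:=(p_0(\eta,\zeta),\dots,p_n(\eta,\zeta))^{\mathrm T}$, $$\Bigl(\mathrm p,\ \mathrm H^{1/2}\,\frac{\mathrm d}{\mathrm dt}\bigl(\mathrm H^{-1/2}\mathrm K\mathrm H^{-1/2}\bigr)\,\mathrm H^{1/2}\,\mathrm p\Bigr)=\frac{(\mathrm p,\mathrm H\mathrm p)}{\cos\bigl(\arg(\overline\zeta\eta)\bigr)-1}\;\frac{\mathrm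 d}{\mathrm dt}\arg\eta .$$ -/

import Mathlib

open Filter Topology
open scoped Polynomial ComplexConjugate ComplexOrder MatrixOrder

noncomputable section

namespace Hessenberg

/-- The factor `diag(I_j, Θ(a), I_{n-j-1})` of order `n+1`, where `Θ(a)` is the 2-by-2 block with
rows `(conj a, ρ)` and `(ρ, -a)`, `ρ = (1 - |a|^2)^{1/2}`, occupying the rows and columns
`j` and `j+1` (indices start from `0`). -/
def rotFactor (n j : ℕ) (a : ℂ) : Matrix (Fin (n + 1)) (Fin (n + 1)) ℂ :=
  Matrix.of fun r c =>
    if r.val = j ∧ c.val = j then conj a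
    else if r.val = j ∧ c.val = j + 1 then ((Real.sqrt (1 - ‖a‖ ^ 2) : ℝ) : ℂ)
    else if r.val = j + 1 ∧ c.val = j then ((Real.sqrt (1 - ‖a‖ ^ 2) : ℝ) : ℂ)
    else if r.val = j + 1 ∧ c.val = j + 1 then -a
    else if r = c then 1 else 0

/-- The last factor `diag(I_n, conj τ)` of order `n+1`. -/
def lastFactor (n : ℕ) (τ : ℂ) : Matrix (Fin (n + 1)) (Fin (n + 1)) ℂ :=
  Matrix.diagonal fun r => if r.val = n then conj τ else 1

/-- The matrix `G(α_0, …, α_{n-1}, τ) = G_0 G_1 ⋯ G_n`. Only `α 0, …, α (n-1)` are used. -/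
def G (n : ℕ) (α : ℕ → ℂ) (τ : ℂ) : Matrix (Fin (n + 1)) (Fin (n + 1)) ℂ :=
  ((List.range n).map fun j => rotFactor n j (α j)).prod * lastFactor n τ

/-- `z` is an eigenvalue of the matrix `M`. -/
def IsEigenvalue {m : ℕ} (M : Matrix (Fin m) (Fin m) ℂ) (z : ℂ) : Prop :=
  Module.End.HasEigenvalue (Matrix.toLin' M) z

/-- The pseudoreflexion coefficients `τ_j(ζ)`: `τ_n(ζ) = τ` and, for `j = n-1, …, 0`,
`τ_j(ζ) = (conj ζ * α_j + τ_{j+1}(ζ)) / (conj α_j * τ_{j+1}(ζ) + conj ζ)`.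
(Indices `j > n` do not occur.) -/
def pseudo (n : ℕ) (α : ℕ → ℂ) (τ ζ : ℂ) (j : ℕ) : ℂ :=
  if j < n then
    (conj ζ * α j + pseudo n α τ ζ (j + 1)) / (conj (α j) * pseudo n α τ ζ (j + 1) + conj ζ)
  else τ
termination_by n - j

/-- `prevCoeff α j` is `α_{j-1}`, with the usual convention `α_{-1} = -1`. -/
def prevCoeff (α : ℕ → ℂ) : ℕ → ℂ
  | 0 => -1
  | j + 1 => α j

/-- The numbers `β_j(ζ)`, `0 ≤ j ≤ n`; `s` is the chosen square root of `ζ`. -/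
def beta (n : ℕ) (α : ℕ → ℂ) (τ ζ s : ℂ) : ℕ → ℂ
  | 0 => 1 / (conj s - pseudo n α τ ζ 0 * s)
  | j + 1 =>
      1 / beta n α τ ζ s j
        * (1 / (conj ζ + pseudo n α τ ζ j * conj (prevCoeff α j)))
        * (1 / (1 - conj (pseudo n α τ ζ j) * α j))

/-- The polynomials `p_j(z, ζ)`: `p_0` is the constant `p₀`, and
`p_{j+1} = (β_j + conj β_j z) p_j - z p_{j-1}` with `p_{-1} = 0`. -/
def poly (n : ℕ) (α : ℕ → ℂ) (τ ζ s : ℂ) (p₀ : ℝ) : ℕ → ℂ[X]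
  | 0 => Polynomial.C (p₀ : ℂ)
  | 1 => (Polynomial.C (beta n α τ ζ s 0) + Polynomial.C (conj (beta n α τ ζ s 0)) * Polynomial.X) * Polynomial.C (p₀ : ℂ)
  | j + 2 =>
      (Polynomial.C (beta n α τ ζ s (j + 1)) + Polynomial.C (conj (beta n α τ ζ s (j + 1))) * Polynomial.X)
          * poly n α τ ζ s p₀ (j + 1)
        - Polynomial.X * poly n α τ ζ s p₀ j

/-- The lower bidiagonal matrix `A`: `s` times the matrix with diagonal
`conj β_0, …, conj β_n` and all subdiagonal entries equal to `-1`. -/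
def A (n : ℕ) (α : ℕ → ℂ) (τ ζ s : ℂ) : Matrix (Fin (n + 1)) (Fin (n + 1)) ℂ :=
  s • Matrix.of fun r c =>
    if r = c then conj (beta n α τ ζ s r.val)
    else if r.val = c.val + 1 then -1 else 0

/-- The Hermitian part `H = (A + A^*) / 2`. -/
def H (n : ℕ) (α : ℕ → ℂ) (τ ζ s : ℂ) : Matrix (Fin (n + 1)) (Fin (n + 1)) ℂ :=
  (1 / 2 : ℂ) • (A n α τ ζ s + (A n α τ ζ s).conjTranspose)

/-- The matrix `K = (A - A^*) / (2i)`, so that `A = H + iK`. -/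
def K (n : ℕ) (α : ℕ → ℂ) (τ ζ s : ℂ) : Matrix (Fin (n + 1)) (Fin (n + 1)) ℂ :=
  (1 / (2 * Complex.I)) • (A n α τ ζ s - (A n α τ ζ s).conjTranspose)

/-- `H^{1/2}`, the positive semidefinite square root. -/
def rootH (n : ℕ) (α : ℕ → ℂ) (τ ζ s : ℂ) : Matrix (Fin (n + 1)) (Fin (n + 1)) ℂ :=
  CFC.sqrt (H n α τ ζ s)

/-- `H^{-1/2} K H^{-1/2}`. -/
def cayley (n : ℕ) (α : ℕ → ℂ) (τ ζ s : ℂ) : Matrix (Fin (n + 1)) (Fin (n + 1)) ℂ :=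
  (rootH n α τ ζ s)⁻¹ * K n α τ ζ s * (rootH n α τ ζ s)⁻¹

/-- The vector `(p_0(z, ζ), …, p_n(z, ζ))`. -/
def polyVec (n : ℕ) (α : ℕ → ℂ) (τ ζ s : ℂ) (p₀ : ℝ) (z : ℂ) : Fin (n + 1) → ℂ :=
  fun j => (poly n α τ ζ s p₀ j.val).eval z

/-- The quadratic form `(x, M x)`. -/
def quadForm {m : ℕ} (M : Matrix (Fin m) (Fin m) ℂ) (x : Fin m → ℂ) : ℂ :=
  star x ⬝ᵥ (M.mulVec x)

/-- The entrywise derivative of a matrix-valued function of a real variable. -/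
def matrixDeriv {m : ℕ} (M : ℝ → Matrix (Fin m) (Fin m) ℂ) (t : ℝ) :
    Matrix (Fin m) (Fin m) ℂ :=
  Matrix.of fun i j => deriv (fun u => M u i j) t

/-- `θ` is a continuous choice of the argument of an eigenvalue of `M` near `t` that starts from
the eigenvalue `η` of `M t`. -/
def IsArgBranch {m : ℕ} (M : ℝ → Matrix (Fin m) (Fin m) ℂ) (t : ℝ) (η : ℂ) (θ : ℝ → ℝ) : Prop :=
  (∀ᶠ u in 𝓝 t, ContinuousAt θ u) ∧
    (∀ᶠ u in 𝓝 t, IsEigenvalue (M u) (Complex.exp (θ u * Complex.I))) ∧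
    Complex.exp (θ t * Complex.I) = η

end Hessenberg

end

/-!
Elimination with positive pivots shows that `H` is positive definite. The three-term recurrence
says that `(ζ̄ z A + Aᴴ) p(z)` is a multiple of the last basis vector with coefficient
`p_{n+1}(z)`. Hence the Hermitian pencil annihilates `p(z)` exactly at the zeros of `p_{n+1}`, which
forces these zeros to be simple, unimodular and different from `ζ`. The left eigenvectors of `G` are
given by Szegő polynomials, and up to a scalar these polynomials satisfy the same recurrence, so the
zeros are the eigenvalues of `G`.

The Cayley transform `w ↦ i (1 + w) / (w - 1)` of `w = ζ̄ z` turns the pencil into the eigenproblem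
of the Hermitian matrix `H^{-1/2} K H^{-1/2}` with eigenvector `H^{1/2} p(z)`. Differentiating an
eigenvalue of this matrix by the Hellmann-Feynman formula, and the Cayley transform by the chain
rule, gives the identity. Branches of eigenvalues exist and are differentiable by the implicit
function theorem, because the zeros of the characteristic polynomial of `G` are simple.
-/

noncomputable section

namespace Hessenberg

open scoped Matrix

section Pencil

variable {ι 𝕜 : Type*} [Fintype ι] [RCLike 𝕜] {M : Matrix ι ι 𝕜} {w c : 𝕜} {x y : ι → 𝕜}

theorem star_dotProduct_conjTranspose_mulVec (M : Matrix ι ι 𝕜) (x y : ι → 𝕜) :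
    star x ⬝ᵥ Mᴴ *ᵥ y = star (star y ⬝ᵥ M *ᵥ x) := by
  rw [Matrix.star_dotProduct, Matrix.star_mulVec, Matrix.dotProduct_mulVec,
    Matrix.conjTranspose_conjTranspose, dotProduct_comm]

theorem star_dotProduct_mulVec_ne_zero (hM : (M + Mᴴ).PosDef) (hx : x ≠ 0) :
    star x ⬝ᵥ M *ᵥ x ≠ 0 := by
  intro h
  have hpos := hM.dotProduct_mulVec_pos hx
  rw [Matrix.add_mulVec, dotProduct_add, star_dotProduct_conjTranspose_mulVec, h] at hpos
  simp at hpos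

theorem norm_eq_one_of_pencil (hM : (M + Mᴴ).PosDef) (hx : x ≠ 0)
    (h : w • M *ᵥ x + Mᴴ *ᵥ x = 0) : ‖w‖ = 1 := by
  have hform : w * (star x ⬝ᵥ M *ᵥ x) + star (star x ⬝ᵥ M *ᵥ x) = 0 := by
    rw [← star_dotProduct_conjTranspose_mulVec, ← smul_eq_mul, ← dotProduct_smul,
      ← dotProduct_add, h, dotProduct_zero]
  have hnorm := congrArg norm (eq_neg_of_add_eq_zero_left hform)
  rw [norm_neg, norm_star, norm_mul] at hnorm
  exact (mul_eq_right₀ (norm_ne_zero_iff.mpr (star_dotProduct_mulVec_ne_zero hM hx))).mp hnorm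

theorem ne_one_of_pencil (hM : (M + Mᴴ).PosDef) (hx : x ≠ 0)
    (h : w • M *ᵥ x + Mᴴ *ᵥ x = 0) : w ≠ 1 := by
  rintro rfl
  rw [one_smul, ← Matrix.add_mulVec] at h
  have hpos := hM.dotProduct_mulVec_pos hx
  rw [h, dotProduct_zero] at hpos
  exact hpos.false

theorem eq_zero_of_pencil_chain (hM : (M + Mᴴ).PosDef) (hx : x ≠ 0)
    (h : w • M *ᵥ x + Mᴴ *ᵥ x = 0) (hy : w • M *ᵥ y + Mᴴ *ᵥ y + c • M *ᵥ x = 0) : c = 0 := by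
  have hw : w * star w = 1 := by
    rw [RCLike.star_def, RCLike.mul_conj, norm_eq_one_of_pencil hM hx h]; norm_num
  have hyx : w * (star x ⬝ᵥ M *ᵥ y) + star (star y ⬝ᵥ M *ᵥ x) + c * (star x ⬝ᵥ M *ᵥ x) = 0 := by
    simpa only [dotProduct_add, dotProduct_smul, dotProduct_zero, smul_eq_mul,
      star_dotProduct_conjTranspose_mulVec] using congrArg (star x ⬝ᵥ ·) hy
  have hxy : star w * star (star y ⬝ᵥ M *ᵥ x) + star x ⬝ᵥ M *ᵥ y = 0 := by
    simpa only [dotProduct_add, dotProduct_smul, dotProduct_zero, smul_eq_mul, star_add, star_mul',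
      star_star, star_zero, star_dotProduct_conjTranspose_mulVec]
      using congrArg (fun v => star (star y ⬝ᵥ v)) h
  refine (mul_eq_zero.mp ?_).resolve_right (star_dotProduct_mulVec_ne_zero hM hx)
  linear_combination hyx - w * hxy + star (star y ⬝ᵥ M *ᵥ x) * hw

end Pencil

section CayleyTransform

/-- The image `i (1 + w) / (w - 1)` of `w` under the Cayley transform, which maps the unit circle
without `1` to the real line. -/
def cayleyValue (w : ℂ) : ℂ := Complex.I * (1 + w) / (w - 1)

theorem mulVec_eq_cayleyValue_smul {ι : Type*} [Fintype ι] {M : Matrix ι ι ℂ} {w : ℂ} {x : ι → ℂ}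
    (h : w • M *ᵥ x + Mᴴ *ᵥ x = 0) (hw : w ≠ 1) :
    ((1 / (2 * Complex.I)) • (M - Mᴴ)) *ᵥ x =
      cayleyValue w • ((1 / 2 : ℂ) • (M + Mᴴ)) *ᵥ x := by
  have hw' := sub_ne_zero.mpr hw
  have hI := Complex.I_ne_zero
  rw [Matrix.smul_mulVec, Matrix.smul_mulVec, Matrix.add_mulVec, Matrix.sub_mulVec,
    eq_neg_of_add_eq_zero_right h]
  ext i
  simp only [Pi.smul_apply, Pi.sub_apply, Pi.add_apply, Pi.neg_apply, smul_eq_mul, cayleyValue]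
  field_simp
  linear_combination (w - 1) * (1 + w) * (M *ᵥ x) i * Complex.I_sq

theorem two_mul_mul_re_sub_one {w : ℂ} (hw : ‖w‖ = 1) : 2 * w * (w.re - 1) = (w - 1) ^ 2 := by
  have hnorm : conj w * w = 1 := by rw [Complex.conj_mul', hw]; norm_num
  have hre : w + conj w = 2 * w.re := by rw [Complex.add_conj]; push_cast; ring
  linear_combination (-w) * hre + hnorm

theorem hasDerivAt_cayleyValue_exp {θ : ℝ → ℝ} {θ' t : ℝ} {a : ℂ} (ha : ‖a‖ = 1)
    (hθ : HasDerivAt θ θ' t) (hne : a * Complex.exp (θ t * Complex.I) ≠ 1) :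
    HasDerivAt (fun u => cayleyValue (a * Complex.exp (θ u * Complex.I)))
      (θ' / ((Real.cos (Complex.arg (a * Complex.exp (θ t * Complex.I))) - 1 : ℝ) : ℂ)) t := by
  have hderiv := ((hθ.ofReal_comp.mul_const Complex.I).cexp).const_mul a
  set w := a * Complex.exp (θ t * Complex.I) with hw_def
  have hw : ‖w‖ = 1 := by
    rw [hw_def, norm_mul, Complex.norm_exp_ofReal_mul_I, ha, one_mul]
  have hcos : Real.cos (Complex.arg w) = w.re := by
    rw [Complex.cos_arg (norm_ne_zero_iff.mp (hw ▸ one_ne_zero)), hw, div_one]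
  have hw1 : w - 1 ≠ 0 := sub_ne_zero.mpr hne
  have hre := two_mul_mul_re_sub_one hw
  have hre1 : (w.re : ℂ) - 1 ≠ 0 := fun h0 => pow_ne_zero 2 hw1 (by rw [← hre, h0, mul_zero])
  refine (((hderiv.const_add 1).const_mul Complex.I).div (hderiv.sub_const 1) hw1).congr_deriv ?_
  rw [hcos, Complex.ofReal_sub, Complex.ofReal_one, div_eq_div_iff (pow_ne_zero 2 hw1) hre1, ← hre]
  linear_combination (-2 * w * θ' * (w.re - 1)) * Complex.I_sq

end CayleyTransform

section SquareRoot

variable {ι 𝕜 : Type*} [Fintype ι] [RCLike 𝕜]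

theorem eq_zero_of_mul_add_mul_eq_zero {R X : Matrix ι ι 𝕜} (hR : R.PosDef)
    (h : R * X + X * R = 0) : X = 0 := by
  classical
  have hXRX := hR.posSemidef.conjTranspose_mul_mul_same X
  have hXRX' := hR.posSemidef.mul_mul_conjTranspose_same X
  have htrace : (Xᴴ * R * X).trace + (X * R * Xᴴ).trace = 0 := by
    rw [Matrix.trace_mul_comm (X * R), ← Matrix.trace_add, Matrix.mul_assoc, ← Matrix.mul_add, h,
      Matrix.mul_zero, Matrix.trace_zero]
  have hzero : Xᴴ * R * X = 0 := hXRX.trace_eq_zero_iff.mp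
    ((add_eq_zero_iff_of_nonneg hXRX.trace_nonneg hXRX'.trace_nonneg).mp htrace).1
  refine Matrix.ext_of_mulVec_single fun j => ?_
  rw [Matrix.zero_mulVec]
  by_contra hne
  have hpos := hR.dotProduct_mulVec_pos hne
  rw [Matrix.star_mulVec, ← Matrix.dotProduct_mulVec, Matrix.mulVec_mulVec, Matrix.mulVec_mulVec,
    hzero, Matrix.zero_mulVec, dotProduct_zero] at hpos
  exact hpos.false

variable [DecidableEq ι]

theorem posDef_sqrt {M : Matrix ι ι 𝕜} (hM : M.PosDef) : (CFC.sqrt M).PosDef :=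
  Matrix.isStrictlyPositive_iff_posDef.mp
    (IsStrictlyPositive.sqrt _ (Matrix.isStrictlyPositive_iff_posDef.mpr hM))

theorem sandwich_inv_mulVec {R K : Matrix ι ι 𝕜} {c : 𝕜} {x : ι → 𝕜} (hR : IsUnit R)
    (h : K *ᵥ x = c • (R * R) *ᵥ x) : (R⁻¹ * K * R⁻¹) *ᵥ (R *ᵥ x) = c • R *ᵥ x := by
  have hdet := (Matrix.isUnit_iff_isUnit_det _).mp hR
  rw [Matrix.mulVec_mulVec, Matrix.nonsing_inv_mul_cancel_right _ _ hdet, ← Matrix.mulVec_mulVec, h,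
    Matrix.mulVec_smul, Matrix.mulVec_mulVec, Matrix.nonsing_inv_mul_cancel_left _ _ hdet]

end SquareRoot

section Differentiability

theorem differentiableAt_matrix_iff {ι κ E F : Type*} [Finite κ]
    [NormedAddCommGroup E] [NormedSpace ℝ E] [NormedAddCommGroup F] [NormedSpace ℝ F]
    {M : E → Matrix ι κ F} {t : E} :
    DifferentiableAt ℝ M t ↔ ∀ i j, DifferentiableAt ℝ (fun u => M u i j) t := by
  have := Fintype.ofFinite κ
  exact (differentiableAt_pi (Φ := fun u i => M u i)).trans
    (forall_congr' fun _ => differentiableAt_pi)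

variable {ι E : Type*} [Fintype ι] [NormedAddCommGroup E] [NormedSpace ℝ E] {t : E}

open scoped Matrix.Norms.L2Operator

theorem hasStrictFDerivAt_mul_self {R : Matrix ι ι ℂ} (hR : R.PosDef) :
    ∃ e : Matrix ι ι ℂ ≃L[ℝ] Matrix ι ι ℂ,
      HasStrictFDerivAt (fun X : Matrix ι ι ℂ => X * X)
        (e : Matrix ι ι ℂ →L[ℝ] Matrix ι ι ℂ) R := by
  classical
  have hinj : Function.Injective (LinearMap.mulLeft ℝ R + LinearMap.mulRight ℝ R) := by
    rw [← LinearMap.ker_eq_bot, LinearMap.ker_eq_bot']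
    exact fun X hX => eq_zero_of_mul_add_mul_eq_zero hR hX
  refine ⟨(LinearEquiv.ofInjectiveEndo _ hinj).toContinuousLinearEquiv, ?_⟩
  exact ((hasStrictFDerivAt_id R).mul' (hasStrictFDerivAt_id R)).congr_fderiv (by ext1 X; rfl)

variable [DecidableEq ι]

theorem differentiableAt_sqrt {M : E → Matrix ι ι ℂ}
    (hM : DifferentiableAt ℝ M t) (hpos : ∀ᶠ u in 𝓝 t, (M u).PosDef) :
    DifferentiableAt ℝ (fun u => CFC.sqrt (M u)) t := by
  have hM0 := hpos.self_of_nhds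
  have hcont : ContinuousAt (fun u => CFC.sqrt (M u)) t :=
    (CFC.continuousOn_sqrt (A := Matrix ι ι ℂ) (M t) hM0.posSemidef.nonneg).tendsto.comp
      (tendsto_nhdsWithin_iff.mpr ⟨hM.continuousAt, hpos.mono fun u hu => hu.posSemidef.nonneg⟩)
  obtain ⟨e, he⟩ := hasStrictFDerivAt_mul_self (posDef_sqrt hM0)
  have hinv := he.to_localInverse.hasFDerivAt.differentiableAt
  rw [CFC.sqrt_mul_sqrt_self _ hM0.posSemidef.nonneg] at hinv
  refine (hinv.comp t hM).congr_of_eventuallyEq ?_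
  filter_upwards [hpos, hcont.eventually he.eventually_left_inverse] with u hu hleft
  rw [CFC.sqrt_mul_sqrt_self (M u) hu.posSemidef.nonneg] at hleft
  exact hleft.symm

theorem differentiableAt_sandwich_inv {R K : E → Matrix ι ι ℂ}
    (hR : DifferentiableAt ℝ R t) (hK : DifferentiableAt ℝ K t) (hunit : IsUnit (R t)) :
    DifferentiableAt ℝ (fun u => (R u)⁻¹ * K u * (R u)⁻¹) t := by
  have hinv : DifferentiableAt ℝ (fun u => (R u)⁻¹) t := by
    simp only [Matrix.nonsing_inv_eq_ringInverse]
    exact (differentiableAt_inverse hunit).comp t hR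
  exact (hinv.mul hK).mul hinv

end Differentiability

section HellmannFeynman

variable {ι 𝕜 : Type*} [Fintype ι] [RCLike 𝕜]

theorem hasDerivAt_eigenvalue {C : ℝ → Matrix ι ι 𝕜} {C' : Matrix ι ι 𝕜} {x : ℝ → ι → 𝕜}
    {lam : ℝ → 𝕜} {t : ℝ} (hC : ∀ i j, HasDerivAt (fun u => C u i j) (C' i j) t)
    (hherm : (C t).IsHermitian) (hx : ContinuousAt x t) (hx0 : x t ≠ 0)
    (hev : ∀ᶠ u in 𝓝 t, C u *ᵥ x u = lam u • x u) :
    HasDerivAt lam ((star (x t) ⬝ᵥ C' *ᵥ x t) / (star (x t) ⬝ᵥ x t)) t := by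
  have hne : star (x t) ⬝ᵥ x t ≠ 0 := fun h => hx0 (dotProduct_star_self_eq_zero.mp h)
  have hleft : star (x t) ᵥ* C t = star (lam t) • star (x t) := by
    rw [← star_smul, ← hev.self_of_nhds, Matrix.star_mulVec, hherm.eq]
  have hreal : star (lam t) = lam t := by
    have h := congrArg (· ⬝ᵥ x t) hleft
    simp only [← Matrix.dotProduct_mulVec, hev.self_of_nhds, dotProduct_smul, smul_dotProduct,
      smul_eq_mul] at h
    exact (mul_right_cancel₀ hne h).symm
  have hxi := tendsto_pi_nhds.mp hx.tendsto
  have hden : Tendsto (fun u => star (x t) ⬝ᵥ x u) (𝓝 t) (𝓝 (star (x t) ⬝ᵥ x t)) :=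
    tendsto_finsetSum _ fun i _ => (hxi i).const_mul _
  have hnum : Tendsto (fun u => star (x t) ⬝ᵥ
      (Matrix.of fun i j => slope (fun v => C v i j) t u) *ᵥ x u) (𝓝[≠] t)
      (𝓝 (star (x t) ⬝ᵥ C' *ᵥ x t)) :=
    tendsto_finsetSum _ fun i _ => .const_mul _ <| tendsto_finsetSum _ fun j _ =>
      (hasDerivAt_iff_tendsto_slope.mp (hC i j)).mul ((hxi j).mono_left nhdsWithin_le_nhds)
  rw [hasDerivAt_iff_tendsto_slope]
  refine (hnum.div (hden.mono_left nhdsWithin_le_nhds) hne).congr' ?_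
  filter_upwards [nhdsWithin_le_nhds hev, nhdsWithin_le_nhds (hden.eventually_ne hne)]
    with u hu hdu
  have hslope : (Matrix.of fun i j => slope (fun v => C v i j) t u) = (u - t)⁻¹ • (C u - C t) := by
    ext i j
    simp [slope]
  rw [Pi.div_apply, div_eq_iff hdu, hslope, Matrix.smul_mulVec, dotProduct_smul, Matrix.sub_mulVec,
    dotProduct_sub, hu, Matrix.dotProduct_mulVec, hleft, hreal, dotProduct_smul, smul_dotProduct,
    slope, vsub_eq_sub, ← sub_smul, smul_eq_mul, smul_mul_assoc]

end HellmannFeynman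

section SimpleEigenvalue

open scoped Matrix.Norms.Elementwise

variable {ι 𝕜 : Type*} [Fintype ι] [DecidableEq ι] [RCLike 𝕜]

theorem contDiff_eval_charpoly {m : WithTop ℕ∞} :
    ContDiff 𝕜 m fun p : Matrix ι ι 𝕜 × 𝕜 => p.1.charpoly.eval p.2 := by
  have hdet (p : Matrix ι ι 𝕜 × 𝕜) :
      p.1.charpoly.eval p.2 = (Matrix.diagonal (fun _ => p.2) - p.1).det := by
    rw [Matrix.charpoly, ← Polynomial.coe_evalRingHom, RingHom.map_det]
    congr 1
    ext i j
    by_cases h : i = j <;> simp [h]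
  simp only [hdet, Matrix.det_apply, Matrix.sub_apply]
  refine ContDiff.sum fun σ _ => ContDiff.const_smul _ (contDiff_prod fun i _ => ContDiff.sub ?_ ?_)
  · simp only [Matrix.diagonal_apply]
    split_ifs <;> fun_prop
  · have h : ContDiff 𝕜 m fun M : Matrix ι ι 𝕜 => M (σ i) i := contDiff_apply_apply ..
    exact h.comp contDiff_fst

theorem exists_differentiableAt_isRoot_charpoly {M₀ : Matrix ι ι 𝕜} {z₀ : 𝕜}
    (hroot : M₀.charpoly.IsRoot z₀) (hsimple : M₀.charpoly.derivative.eval z₀ ≠ 0) :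
    ∃ φ : Matrix ι ι 𝕜 → 𝕜, φ M₀ = z₀ ∧ DifferentiableAt 𝕜 φ M₀ ∧
      (∀ᶠ M in 𝓝 M₀, ContinuousAt φ M) ∧ (∀ᶠ M in 𝓝 M₀, M.charpoly.IsRoot (φ M)) ∧
      ∀ᶠ p in 𝓝 (M₀, z₀), p.1.charpoly.IsRoot p.2 → φ p.1 = p.2 := by
  have hF : ContDiffAt 𝕜 1 (fun p : Matrix ι ι 𝕜 × 𝕜 => p.1.charpoly.eval p.2) (M₀, z₀) :=
    contDiff_eval_charpoly.contDiffAt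
  have hpartial : (fderiv 𝕜 (fun p : Matrix ι ι 𝕜 × 𝕜 => p.1.charpoly.eval p.2) (M₀, z₀) ∘L
      .inr 𝕜 (Matrix ι ι 𝕜) 𝕜).IsInvertible := by
    refine ⟨ContinuousLinearEquiv.unitsEquivAut 𝕜 (Units.mk0 _ hsimple), ?_⟩
    ext
    have hcomp := ((hF.differentiableAt one_ne_zero).hasFDerivAt.comp z₀
      (hasFDerivAt_prodMk_right M₀ z₀)).hasDerivAt.unique (M₀.charpoly.hasDerivAt z₀)
    exact Eq.trans (by simp) hcomp.symm
  refine ⟨hF.implicitFunction one_ne_zero hpartial, hF.implicitFunction_apply_self _ _,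
    (hF.contDiffAt_implicitFunction _ _).differentiableAt one_ne_zero,
    ((hF.contDiffAt_implicitFunction _ _).eventually (by simp)).mono fun M hM => hM.continuousAt,
    ?_, ?_⟩
  · filter_upwards [hF.eventually_apply_implicitFunction one_ne_zero hpartial] with M hM
    exact hM.trans hroot
  · filter_upwards [hF.eventually_apply_eq_iff_implicitFunction one_ne_zero hpartial] with p hp hz
    exact hp.mp (hz.trans hroot.symm)

end SimpleEigenvalue

section Argument

theorem argument_eq_add_im_log {x y : ℝ} {z w : ℂ} (hx : Complex.exp (x * Complex.I) = z)
    (hy : Complex.exp (y * Complex.I) = w) (hxy : |x - y| < Real.pi) :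
    x = y + (Complex.log (z / w)).im := by
  have h := abs_lt.mp hxy
  rw [← hx, ← hy, ← Complex.exp_sub, ← sub_mul, ← Complex.ofReal_sub,
    Complex.log_exp (by simpa using h.1) (by simpa using h.2.le)]
  simp

theorem differentiableAt_argument {E : Type*} [NormedAddCommGroup E] [NormedSpace ℝ E] {θ : E → ℝ}
    {z : E → ℂ} {t : E} (hθ : ContinuousAt θ t) (hz : DifferentiableAt ℝ z t)
    (h : ∀ᶠ u in 𝓝 t, Complex.exp (θ u * Complex.I) = z u) : DifferentiableAt ℝ θ t := by
  have hne : z t ≠ 0 := h.self_of_nhds ▸ Complex.exp_ne_zero _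
  have hslit : z t / z t ∈ Complex.slitPlane := by
    rw [div_self hne]
    exact Complex.one_mem_slitPlane
  have hdiv : DifferentiableAt ℝ (fun u => z u / z t) t := by
    simpa only [div_eq_mul_inv] using hz.mul_const (z t)⁻¹
  have hlog : DifferentiableAt ℝ (fun u => Complex.log (z u / z t)) t :=
    DifferentiableAt.comp (g := Complex.log) (f := fun u => z u / z t) t
      ((Complex.differentiableAt_log hslit).restrictScalars ℝ) hdiv
  refine ((Complex.imCLM.differentiableAt.comp t hlog).const_add (θ t)).congr_of_eventuallyEq ?_
  filter_upwards [h, Metric.continuousAt_iff'.mp hθ Real.pi Real.pi_pos] with u hu hdist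
  exact argument_eq_add_im_log hu h.self_of_nhds (by rwa [Real.dist_eq] at hdist)

theorem exists_continuousAt_argument {X : Type*} [TopologicalSpace X] {z : X → ℂ} {x : X}
    (hcont : ∀ᶠ u in 𝓝 x, ContinuousAt z u) (hnorm : ∀ᶠ u in 𝓝 x, ‖z u‖ = 1) :
    ∃ θ : X → ℝ, (∀ᶠ u in 𝓝 x, ContinuousAt θ u) ∧
      ∀ᶠ u in 𝓝 x, Complex.exp (θ u * Complex.I) = z u := by
  have hne : z x ≠ 0 := norm_ne_zero_iff.mp (hnorm.self_of_nhds ▸ one_ne_zero)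
  have hexp {w : ℂ} (hw : ‖w‖ = 1) : Complex.exp (w.arg * Complex.I) = w := by
    simpa [hw] using Complex.norm_mul_exp_arg_mul_I w
  have hslit : ∀ᶠ u in 𝓝 x, z u / z x ∈ Complex.slitPlane :=
    (hcont.self_of_nhds.div_const (z x)).eventually
      (Complex.isOpen_slitPlane.mem_nhds (by simp [div_self hne]))
  refine ⟨fun u => (z x).arg + (z u / z x).arg, ?_, ?_⟩
  · filter_upwards [hcont, hslit] with u hu hu'
    exact (ContinuousAt.comp' (f := fun v => z v / z x) (Complex.continuousAt_arg hu')
      (hu.div_const _)).const_add _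
  · filter_upwards [hnorm] with u hu
    rw [Complex.ofReal_add, add_mul, Complex.exp_add, hexp hnorm.self_of_nhds,
      hexp (by rw [norm_div, hu, hnorm.self_of_nhds, div_one]), mul_div_cancel₀ _ hne]

end Argument

theorem conj_mul_self_of_norm_eq_one {z : ℂ} (hz : ‖z‖ = 1) : conj z * z = 1 := by
  rw [Complex.conj_mul', hz, Complex.ofReal_one, one_pow]

theorem add_ne_zero_of_norm_lt {E : Type*} [SeminormedAddGroup E] {a b : E} (h : ‖a‖ < ‖b‖) :
    a + b ≠ 0 := fun hab => h.ne (by rw [eq_neg_of_add_eq_zero_left hab, norm_neg])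

theorem one_sub_ne_zero_of_norm_lt_one {a : ℂ} (h : ‖a‖ < 1) : 1 - a ≠ 0 := by
  rintro hab
  rw [← sub_eq_zero.mp hab, norm_one] at h
  exact h.false

variable {n : ℕ} {α : ℕ → ℂ} {τ ζ s : ℂ} {j : ℕ}

theorem pseudo_of_lt (hj : j < n) :
    pseudo n α τ ζ j = (conj ζ * α j + pseudo n α τ ζ (j + 1)) /
      (conj (α j) * pseudo n α τ ζ (j + 1) + conj ζ) := by
  rw [pseudo, if_pos hj]

theorem pseudo_of_le (hj : n ≤ j) : pseudo n α τ ζ j = τ := by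
  rw [pseudo, if_neg hj.not_gt]

/-- The standing assumptions at one value of `t`: the coefficients `α_j` lie in the open unit disk,
the last parameter `τ` and the base point `ζ` on the unit circle, and `s` is a square root
of `ζ`. -/
structure Admissible (n : ℕ) (α : ℕ → ℂ) (τ ζ s : ℂ) : Prop where
  norm_coeff : ∀ j < n, ‖α j‖ < 1
  norm_last : ‖τ‖ = 1
  norm_base : ‖ζ‖ = 1
  sq_root : s ^ 2 = ζ

namespace Admissible

theorem norm_root (h : Admissible n α τ ζ s) : ‖s‖ = 1 := by
  have hsq : ‖s‖ ^ 2 = 1 := by rw [← norm_pow, h.sq_root, h.norm_base]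
  exact (pow_eq_one_iff_of_nonneg (norm_nonneg s) two_ne_zero).mp hsq

theorem conj_root_mul (h : Admissible n α τ ζ s) : conj s * s = 1 :=
  conj_mul_self_of_norm_eq_one h.norm_root

theorem conj_root_sq (h : Admissible n α τ ζ s) : conj s ^ 2 = conj ζ := by
  rw [← h.sq_root, map_pow]

theorem conj_base_mul (h : Admissible n α τ ζ s) : conj ζ * ζ = 1 :=
  conj_mul_self_of_norm_eq_one h.norm_base

theorem pseudo_den_ne_zero (h : Admissible n α τ ζ s) (hj : j < n) {w : ℂ} (hw : ‖w‖ = 1) :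
    conj (α j) * w + conj ζ ≠ 0 := by
  apply add_ne_zero_of_norm_lt
  simpa [hw, h.norm_base] using h.norm_coeff j hj

theorem norm_pseudo (h : Admissible n α τ ζ s) (j : ℕ) : ‖pseudo n α τ ζ j‖ = 1 := by
  by_cases hj : j < n
  · have ih := h.norm_pseudo (j + 1)
    rw [pseudo_of_lt hj, norm_div,
      div_eq_one_iff_eq (norm_ne_zero_iff.mpr (h.pseudo_den_ne_zero hj ih))]
    set w := pseudo n α τ ζ (j + 1)
    have hnum : conj ζ * α j + w = conj ζ * w * conj (conj (α j) * w + conj ζ) := by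
      simp only [map_add, map_mul, Complex.conj_conj]
      linear_combination (-(conj ζ * α j)) * conj_mul_self_of_norm_eq_one ih - w * h.conj_base_mul
    rw [hnum, norm_mul, norm_mul, Complex.norm_conj, Complex.norm_conj, ih, h.norm_base, one_mul,
      one_mul]
  · rw [pseudo_of_le (not_lt.mp hj), h.norm_last]
termination_by n - j

theorem conj_pseudo_mul (h : Admissible n α τ ζ s) (j : ℕ) :
    conj (pseudo n α τ ζ j) * pseudo n α τ ζ j = 1 :=
  conj_mul_self_of_norm_eq_one (h.norm_pseudo j)

theorem pseudo_rec (h : Admissible n α τ ζ s) (hj : j < n) :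
    pseudo n α τ ζ j * (conj (α j) * pseudo n α τ ζ (j + 1) + conj ζ) =
      conj ζ * α j + pseudo n α τ ζ (j + 1) := by
  conv_lhs => rw [pseudo_of_lt hj]
  exact div_mul_cancel₀ _ (h.pseudo_den_ne_zero hj (h.norm_pseudo _))

theorem base_mul_pseudo_succ (h : Admissible n α τ ζ s) (hj : j < n) :
    ζ * pseudo n α τ ζ (j + 1) * (1 - conj (α j) * pseudo n α τ ζ j) =
      pseudo n α τ ζ j - α j := by
  linear_combination (-ζ) * h.pseudo_rec hj + (pseudo n α τ ζ j - α j) * h.conj_base_mul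

theorem factor_ne_zero (h : Admissible n α τ ζ s) (hj : j < n) :
    1 - α j * conj (pseudo n α τ ζ j) ≠ 0 := by
  apply one_sub_ne_zero_of_norm_lt_one
  simpa [h.norm_pseudo] using h.norm_coeff j hj

theorem conj_factor_ne_zero (h : Admissible n α τ ζ s) (hj : j < n) :
    1 - conj (α j) * pseudo n α τ ζ j ≠ 0 := by
  simpa using (map_ne_zero (starRingEnd ℂ)).mpr (h.factor_ne_zero hj)

theorem factor_mul_factor (h : Admissible n α τ ζ s) (hj : j < n) :
    ζ * (conj ζ + pseudo n α τ ζ (j + 1) * conj (α j)) * (1 - conj (α j) * pseudo n α τ ζ j) =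
      1 - conj (α j) * α j := by
  linear_combination conj (α j) * h.base_mul_pseudo_succ hj +
    (1 - conj (α j) * pseudo n α τ ζ j) * h.conj_base_mul

end Admissible

/-- The pivots of Gaussian elimination on the tridiagonal matrix `A + A^*`, which turn out to be
`m_0 = 1` and `m_{j+1} = (1 - |α_j|^2) / (m_j |1 - α_j conj τ_j|^2)`. -/
def pivot (n : ℕ) (α : ℕ → ℂ) (τ ζ : ℂ) : ℕ → ℝ
  | 0 => 1
  | j + 1 => (1 - ‖α j‖ ^ 2) / (pivot n α τ ζ j * ‖1 - α j * conj (pseudo n α τ ζ j)‖ ^ 2)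

namespace Admissible

theorem one_sub_norm_sq_pos (h : Admissible n α τ ζ s) (hj : j < n) : 0 < 1 - ‖α j‖ ^ 2 := by
  nlinarith [h.norm_coeff j hj, norm_nonneg (α j)]

theorem pivot_pos (h : Admissible n α τ ζ s) (hj : j ≤ n) : 0 < pivot n α τ ζ j := by
  induction j with
  | zero => exact one_pos
  | succ j ih =>
    have hm := ih (by omega)
    have hρ := h.one_sub_norm_sq_pos (j := j) (by omega)
    have hfactor := norm_pos_iff.mpr (h.factor_ne_zero (j := j) (by omega))
    rw [pivot]
    positivity

theorem pivot_ne_zero (h : Admissible n α τ ζ s) (hj : j ≤ n) : (pivot n α τ ζ j : ℂ) ≠ 0 :=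
  Complex.ofReal_ne_zero.mpr (h.pivot_pos hj).ne'

theorem pivot_succ_mul (h : Admissible n α τ ζ s) (hj : j < n) :
    (pivot n α τ ζ (j + 1) : ℂ) * pivot n α τ ζ j *
      ((1 - α j * conj (pseudo n α τ ζ j)) * (1 - conj (α j) * pseudo n α τ ζ j)) =
      1 - conj (α j) * α j := by
  have hconj : 1 - conj (α j) * pseudo n α τ ζ j = conj (1 - α j * conj (pseudo n α τ ζ j)) := by
    simp
  rw [hconj, Complex.mul_conj', Complex.conj_mul']
  norm_cast
  have hm := (h.pivot_pos hj.le).ne'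
  have hfactor := norm_ne_zero_iff.mpr (h.factor_ne_zero hj)
  rw [pivot]
  field_simp

end Admissible

/-- Admissible parameters for which moreover `τ_0(ζ) ζ ≠ 1`, so that the denominator of `β_0(ζ)`
does not vanish. This holds as soon as `ζ` is not an eigenvalue of `G`. -/
structure Regular (n : ℕ) (α : ℕ → ℂ) (τ ζ s : ℂ) : Prop extends Admissible n α τ ζ s where
  pseudo_mul_base_ne : pseudo n α τ ζ 0 * ζ ≠ 1

namespace Regular

theorem beta_zero_den_ne_zero (h : Regular n α τ ζ s) : conj s - pseudo n α τ ζ 0 * s ≠ 0 := by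
  refine fun hden => h.pseudo_mul_base_ne ?_
  linear_combination (-s) * hden + h.conj_root_mul - pseudo n α τ ζ 0 * h.sq_root

theorem beta_zero_mul (h : Regular n α τ ζ s) :
    beta n α τ ζ s 0 * (conj s - pseudo n α τ ζ 0 * s) = 1 := by
  rw [beta]
  exact one_div_mul_cancel h.beta_zero_den_ne_zero

theorem conj_beta_zero_mul (h : Regular n α τ ζ s) :
    conj (beta n α τ ζ s 0) * (s - conj (pseudo n α τ ζ 0) * conj s) = 1 := by
  simpa using congrArg (starRingEnd ℂ) h.beta_zero_mul

theorem beta_zero_eq (h : Regular n α τ ζ s) :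
    beta n α τ ζ s 0 = -conj (pseudo n α τ ζ 0) * conj (beta n α τ ζ s 0) := by
  apply mul_right_cancel₀ h.beta_zero_den_ne_zero
  linear_combination h.beta_zero_mul - h.conj_beta_zero_mul -
    conj (beta n α τ ζ s 0) * s * h.conj_pseudo_mul 0

theorem beta_succ_mul_of_beta_mul (h : Regular n α τ ζ s) (hj : j < n)
    (hβ : beta n α τ ζ s j * s * (conj ζ + pseudo n α τ ζ j * conj (prevCoeff α j)) =
      pivot n α τ ζ j) :
    beta n α τ ζ s (j + 1) * (pivot n α τ ζ j * (1 - α j * conj (pseudo n α τ ζ j))) = s := by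
  have hm := h.pivot_ne_zero hj.le
  have hfactor := h.factor_ne_zero hj
  rw [← hβ] at hm ⊢
  obtain ⟨⟨hβj, -⟩, hden⟩ := mul_ne_zero_iff.mp hm |>.imp_left mul_ne_zero_iff.mp
  rw [beta, mul_comm (conj _) (α j)]
  field_simp

theorem beta_mul (h : Regular n α τ ζ s) (hj : j ≤ n) :
    beta n α τ ζ s j * s * (conj ζ + pseudo n α τ ζ j * conj (prevCoeff α j)) =
      pivot n α τ ζ j := by
  induction j with
  | zero =>
    simp only [prevCoeff, pivot, map_neg, map_one, Complex.ofReal_one]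
    linear_combination h.beta_zero_mul + beta n α τ ζ s 0 * conj s * h.conj_root_mul -
      beta n α τ ζ s 0 * s * h.conj_root_sq
  | succ j ih =>
    have hβ := h.beta_succ_mul_of_beta_mul hj (ih (Nat.le_of_succ_le hj))
    apply mul_right_cancel₀ (mul_ne_zero (h.pivot_ne_zero (Nat.le_of_succ_le hj))
      (mul_ne_zero (h.factor_ne_zero hj) (h.conj_factor_ne_zero hj)))
    simp only [prevCoeff]
    linear_combination s * (conj ζ + pseudo n α τ ζ (j + 1) * conj (α j)) *
      (1 - conj (α j) * pseudo n α τ ζ j) * hβ - h.pivot_succ_mul hj + h.factor_mul_factor hj +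
      (conj ζ + pseudo n α τ ζ (j + 1) * conj (α j)) *
      (1 - conj (α j) * pseudo n α τ ζ j) * h.sq_root

theorem beta_succ_mul (h : Regular n α τ ζ s) (hj : j < n) :
    beta n α τ ζ s (j + 1) * (pivot n α τ ζ j * (1 - α j * conj (pseudo n α τ ζ j))) = s :=
  h.beta_succ_mul_of_beta_mul hj (h.beta_mul hj.le)

theorem conj_beta_succ_mul (h : Regular n α τ ζ s) (hj : j < n) :
    conj (beta n α τ ζ s (j + 1)) * (pivot n α τ ζ j * (1 - conj (α j) * pseudo n α τ ζ j)) =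
      conj s := by
  simpa using congrArg (starRingEnd ℂ) (h.beta_succ_mul hj)

theorem beta_ne_zero (h : Regular n α τ ζ s) (hj : j ≤ n) : beta n α τ ζ s j ≠ 0 := by
  intro hβ
  have hm := h.beta_mul hj
  rw [hβ, zero_mul, zero_mul] at hm
  exact h.pivot_ne_zero hj hm.symm

theorem beta_succ_mul_conj_pseudo (h : Regular n α τ ζ s) (hj : j < n) :
    beta n α τ ζ s (j + 1) * conj (pseudo n α τ ζ j) =
      conj (beta n α τ ζ s (j + 1)) * conj (pseudo n α τ ζ (j + 1)) := by
  have hrec : conj ζ * conj (pseudo n α τ ζ (j + 1)) * (1 - α j * conj (pseudo n α τ ζ j)) =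
      conj (pseudo n α τ ζ j) - conj (α j) := by
    simpa using congrArg (starRingEnd ℂ) (h.base_mul_pseudo_succ hj)
  apply mul_right_cancel₀ (mul_ne_zero (h.pivot_ne_zero hj.le)
    (mul_ne_zero (h.factor_ne_zero hj) (h.conj_factor_ne_zero hj)))
  linear_combination conj (pseudo n α τ ζ j) * (1 - conj (α j) * pseudo n α τ ζ j) *
      h.beta_succ_mul hj -
    conj (pseudo n α τ ζ (j + 1)) * (1 - α j * conj (pseudo n α τ ζ j)) *
      h.conj_beta_succ_mul hj - s * hrec - s * conj (α j) * h.conj_pseudo_mul j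
    - conj (pseudo n α τ ζ (j + 1)) * (1 - α j * conj (pseudo n α τ ζ j)) *
      (s * h.conj_root_sq - conj s * h.conj_root_mul)

theorem two_re_beta_zero (h : Regular n α τ ζ s) :
    s * conj (beta n α τ ζ s 0) + conj s * beta n α τ ζ s 0 = pivot n α τ ζ 0 := by
  apply mul_right_cancel₀ (mul_ne_zero h.beta_zero_den_ne_zero
    (right_ne_zero_of_mul_eq_one h.conj_beta_zero_mul))
  simp only [pivot, Complex.ofReal_one]
  linear_combination s * (conj s - pseudo n α τ ζ 0 * s) * h.conj_beta_zero_mul +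
    conj s * (s - conj (pseudo n α τ ζ 0) * conj s) * h.beta_zero_mul -
    (conj s * s) * h.conj_pseudo_mul 0

theorem two_re_beta_succ (h : Regular n α τ ζ s) (hj : j < n) :
    s * conj (beta n α τ ζ s (j + 1)) + conj s * beta n α τ ζ s (j + 1) =
      pivot n α τ ζ (j + 1) + (pivot n α τ ζ j : ℂ)⁻¹ := by
  have hm := h.pivot_ne_zero hj.le
  apply mul_right_cancel₀ (mul_ne_zero hm
    (mul_ne_zero (h.factor_ne_zero hj) (h.conj_factor_ne_zero hj)))
  linear_combination s * (1 - α j * conj (pseudo n α τ ζ j)) * h.conj_beta_succ_mul hj +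
    conj s * (1 - conj (α j) * pseudo n α τ ζ j) * h.beta_succ_mul hj - h.pivot_succ_mul hj
    + (2 - α j * conj (pseudo n α τ ζ j) - conj (α j) * pseudo n α τ ζ j) * h.conj_root_mul
    - (1 - α j * conj (pseudo n α τ ζ j)) * (1 - conj (α j) * pseudo n α τ ζ j) *
      inv_mul_cancel₀ hm
    - α j * conj (α j) * h.conj_pseudo_mul j

end Regular

theorem A_apply (r c : Fin (n + 1)) : A n α τ ζ s r c =
    (if r = c then s * conj (beta n α τ ζ s r) else 0) +
      if r.val = c.val + 1 then -s else 0 := by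
  simp only [A, Matrix.smul_apply, Matrix.of_apply, smul_eq_mul]
  rcases eq_or_ne r c with rfl | hrc
  · simp
  · simp [hrc]

theorem A_mulVec_zero (x : Fin (n + 1) → ℂ) :
    (A n α τ ζ s *ᵥ x) 0 = s * (conj (beta n α τ ζ s 0) * x 0) := by
  simp [Matrix.mulVec, dotProduct, A_apply, mul_assoc]

theorem A_mulVec_succ (x : Fin (n + 1) → ℂ) (j : Fin n) :
    (A n α τ ζ s *ᵥ x) j.succ =
      s * (conj (beta n α τ ζ s (j + 1)) * x j.succ - x j.castSucc) := by
  have hval (c : Fin (n + 1)) : j.val = c.val ↔ c = j.castSucc :=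
    eq_comm.trans (Fin.ext_iff (b := j.castSucc)).symm
  simp only [Matrix.mulVec, dotProduct, A_apply, Fin.val_succ, Nat.add_right_cancel_iff, hval,
    add_mul, ite_mul, zero_mul, Finset.sum_add_distrib, Finset.sum_ite_eq, Finset.sum_ite_eq',
    Finset.mem_univ, if_true]
  ring

theorem A_conjTranspose_mulVec_castSucc (x : Fin (n + 1) → ℂ) (j : Fin n) :
    ((A n α τ ζ s)ᴴ *ᵥ x) j.castSucc =
      conj s * (beta n α τ ζ s j * x j.castSucc - x j.succ) := by
  have hval (c : Fin (n + 1)) : c.val = j.val + 1 ↔ c = j.succ := (Fin.ext_iff (b := j.succ)).symm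
  simp only [Matrix.mulVec, dotProduct, Matrix.conjTranspose_apply, A_apply, Fin.val_castSucc, hval,
    star_add, apply_ite star, star_zero, star_neg, star_mul', Complex.star_def, Complex.conj_conj,
    add_mul, ite_mul, zero_mul, Finset.sum_add_distrib, Finset.sum_ite_eq', Finset.mem_univ,
    if_true]
  ring

theorem A_conjTranspose_mulVec_last (x : Fin (n + 1) → ℂ) :
    ((A n α τ ζ s)ᴴ *ᵥ x) (Fin.last n) = conj s * (beta n α τ ζ s n * x (Fin.last n)) := by
  have hval (c : Fin (n + 1)) : ¬ c.val = n + 1 := c.isLt.ne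
  simp [Matrix.mulVec, dotProduct, A_apply, hval, apply_ite conj, mul_assoc]

theorem star_dotProduct_A_mulVec (x : Fin (n + 1) → ℂ) :
    star x ⬝ᵥ A n α τ ζ s *ᵥ x = ∑ r : Fin (n + 1), s * conj (beta n α τ ζ s r) * ‖x r‖ ^ 2 -
      ∑ j : Fin n, s * conj (x j.succ) * x j.castSucc := by
  simp only [dotProduct, Pi.star_apply, Fin.sum_univ_succ, A_mulVec_zero, A_mulVec_succ,
    add_sub_assoc, ← Finset.sum_sub_distrib, ← Complex.conj_mul', Complex.star_def, Fin.val_zero,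
    Fin.val_succ]
  congr 1
  · ring
  · exact Finset.sum_congr rfl fun j _ => by ring

namespace Regular

theorem star_dotProduct_A_add_mulVec (h : Regular n α τ ζ s) (x : Fin (n + 1) → ℂ) :
    star x ⬝ᵥ (A n α τ ζ s + (A n α τ ζ s)ᴴ) *ᵥ x =
      ((∑ j : Fin n, pivot n α τ ζ j *
          ‖x j.castSucc - conj s * x j.succ / pivot n α τ ζ j‖ ^ 2 +
        pivot n α τ ζ n * ‖x (Fin.last n)‖ ^ 2 : ℝ) : ℂ) := by
  have hdiag : ∑ r : Fin (n + 1),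
      (s * conj (beta n α τ ζ s r) + conj s * beta n α τ ζ s r) * (‖x r‖ : ℂ) ^ 2 =
      ∑ r : Fin (n + 1), (pivot n α τ ζ r : ℂ) * ‖x r‖ ^ 2 +
        ∑ j : Fin n, (pivot n α τ ζ j : ℂ)⁻¹ * ‖x j.succ‖ ^ 2 := by
    rw [Fin.sum_univ_succ, Fin.sum_univ_succ, add_assoc, ← Finset.sum_add_distrib]
    simp only [Fin.val_zero, Fin.val_succ, h.two_re_beta_zero,
      fun j : Fin n => h.two_re_beta_succ j.isLt, ← add_mul]
  have hsquare (j : Fin n) : (pivot n α τ ζ j : ℂ) *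
      ‖x j.castSucc - conj s * x j.succ / pivot n α τ ζ j‖ ^ 2 =
      pivot n α τ ζ j * ‖x j.castSucc‖ ^ 2 + (pivot n α τ ζ j : ℂ)⁻¹ * ‖x j.succ‖ ^ 2 -
        s * conj (x j.succ) * x j.castSucc - conj s * x j.succ * conj (x j.castSucc) := by
    have hm := h.pivot_ne_zero j.isLt.le
    simp only [← Complex.conj_mul', map_sub, map_mul, map_div₀, Complex.conj_conj,
      Complex.conj_ofReal]
    field_simp
    linear_combination x j.succ * conj (x j.succ) * h.conj_root_mul
  rw [Matrix.add_mulVec, dotProduct_add, star_dotProduct_conjTranspose_mulVec,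
    star_dotProduct_A_mulVec]
  push_cast
  rw [Finset.sum_congr rfl fun j _ => hsquare j]
  rw [Fin.sum_univ_castSucc fun r => (pivot n α τ ζ r : ℂ) * ‖x r‖ ^ 2] at hdiag
  simp only [star_sub, star_sum, star_mul', Complex.star_def, Complex.conj_conj, map_pow,
    Complex.conj_ofReal, Finset.sum_sub_distrib, Finset.sum_add_distrib, add_mul, Fin.val_last,
    Fin.val_castSucc] at hdiag ⊢
  linear_combination hdiag

theorem A_add_conjTranspose_posDef (h : Regular n α τ ζ s) :
    (A n α τ ζ s + (A n α τ ζ s)ᴴ).PosDef := by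
  refine .of_dotProduct_mulVec_pos (Matrix.isHermitian_add_transpose_self _) fun x hx => ?_
  have hterm (j : Fin n) : 0 ≤ pivot n α τ ζ j *
      ‖x j.castSucc - conj s * x j.succ / pivot n α τ ζ j‖ ^ 2 :=
    mul_nonneg (h.pivot_pos j.isLt.le).le (sq_nonneg _)
  have hlast : 0 ≤ pivot n α τ ζ n * ‖x (Fin.last n)‖ ^ 2 :=
    mul_nonneg (h.pivot_pos le_rfl).le (sq_nonneg _)
  have hsum := Finset.sum_nonneg fun j (_ : j ∈ Finset.univ) => hterm j
  rw [h.star_dotProduct_A_add_mulVec, Complex.zero_lt_real]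
  refine (add_nonneg hsum hlast).lt_of_ne' fun hzero => hx (funext fun r => ?_)
  obtain ⟨hsum0, hlast0⟩ := (add_eq_zero_iff_of_nonneg hsum hlast).mp hzero
  induction r using Fin.reverseInduction with
  | last => simpa [(h.pivot_pos le_rfl).ne'] using hlast0
  | cast j ih =>
    have hj := (Finset.sum_eq_zero_iff_of_nonneg fun j _ => hterm j).mp hsum0 j (Finset.mem_univ j)
    simpa [(h.pivot_pos j.isLt.le).ne', ih] using hj

theorem H_posDef (h : Regular n α τ ζ s) : (H n α τ ζ s).PosDef :=
  h.A_add_conjTranspose_posDef.smul (by simp)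

end Regular

section Polynomials

open Polynomial

variable {p₀ : ℝ} {z : ℂ}

theorem natDegree_C_add_C_mul_X_le {R : Type*} [Semiring R] (a b : R) :
    (C a + C b * X).natDegree ≤ 1 := by
  compute_degree

theorem natDegree_poly_le (n : ℕ) (α : ℕ → ℂ) (τ ζ s : ℂ) (p₀ : ℝ) (j : ℕ) :
    (poly n α τ ζ s p₀ j).natDegree ≤ j := by
  induction j using Nat.twoStepInduction with
  | zero => rw [poly, natDegree_C]
  | one =>
    exact natDegree_mul_le_of_le (natDegree_C_add_C_mul_X_le _ _) (natDegree_C _).le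
  | more j ih ih' =>
    rw [poly]
    refine natDegree_sub_le_of_le ?_ ?_ |>.trans_eq (max_self _)
    · exact (natDegree_mul_le_of_le (natDegree_C_add_C_mul_X_le _ _) ih').trans (by omega)
    · exact (natDegree_mul_le_of_le natDegree_X_le ih).trans (by omega)

theorem coeff_poly_self (n : ℕ) (α : ℕ → ℂ) (τ ζ s : ℂ) (p₀ : ℝ) (j : ℕ) :
    (poly n α τ ζ s p₀ j).coeff j = p₀ * ∏ i ∈ Finset.range j, conj (beta n α τ ζ s i) := by
  have hlinear (a b : ℂ) : (C a + C b * X).coeff 1 = b := by simp [coeff_C]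
  induction j using Nat.twoStepInduction with
  | zero => simp [poly]
  | one =>
    simp only [poly, coeff_mul_C, hlinear, Finset.prod_range_one]
    ring
  | more j _ ih =>
    have hlow : (X * poly n α τ ζ s p₀ j).coeff (j + 2) = 0 :=
      coeff_eq_zero_of_natDegree_lt <| lt_of_le_of_lt
        (natDegree_mul_le_of_le natDegree_X_le (natDegree_poly_le ..)) (by omega)
    rw [poly, coeff_sub, hlow, sub_zero, show j + 2 = 1 + (j + 1) by omega,
      coeff_mul_add_eq_of_natDegree_le (natDegree_C_add_C_mul_X_le _ _) (natDegree_poly_le ..),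
      hlinear, ih, show 1 + (j + 1) = j + 1 + 1 by omega, Finset.prod_range_succ _ (j + 1)]
    ring

theorem polyVec_ne_zero (hp : p₀ ≠ 0) (z : ℂ) : polyVec n α τ ζ s p₀ z ≠ 0 := by
  intro h
  have h0 := congrFun h 0
  simp [polyVec, poly, hp] at h0

theorem mul_A_mulVec_polyVec (z : ℂ) (r : Fin (n + 1)) :
    z * (A n α τ ζ s *ᵥ polyVec n α τ ζ s p₀ z) r =
      s * ((poly n α τ ζ s p₀ (r + 1)).eval z -
        beta n α τ ζ s r * (poly n α τ ζ s p₀ r).eval z) := by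
  cases r using Fin.cases with
  | zero =>
    simp only [A_mulVec_zero, polyVec, poly, Fin.val_zero, eval_mul, eval_add, eval_C, eval_X]
    ring
  | succ j =>
    simp only [A_mulVec_succ, polyVec, Fin.val_succ, Fin.val_castSucc]
    rw [poly]
    simp only [eval_mul, eval_add, eval_sub, eval_C, eval_X]
    ring

theorem Admissible.pencil_mulVec_polyVec (h : Admissible n α τ ζ s) (z : ℂ) :
    (conj ζ * z) • A n α τ ζ s *ᵥ polyVec n α τ ζ s p₀ z +
      (A n α τ ζ s)ᴴ *ᵥ polyVec n α τ ζ s p₀ z =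
      (poly n α τ ζ s p₀ (n + 1)).eval z • Pi.single (Fin.last n) (conj s) := by
  have hs : conj ζ * s = conj s := by
    linear_combination (-s) * h.conj_root_sq + conj s * h.conj_root_mul
  ext r
  have hA := mul_A_mulVec_polyVec (n := n) (α := α) (τ := τ) (ζ := ζ) (s := s) (p₀ := p₀) z r
  rw [Pi.add_apply, Pi.smul_apply, smul_eq_mul, mul_assoc, hA, Pi.smul_apply]
  cases r using Fin.lastCases with
  | last =>
    simp only [A_conjTranspose_mulVec_last, polyVec, Pi.single_eq_same, smul_eq_mul, Fin.val_last]
    linear_combination ((poly n α τ ζ s p₀ (n + 1)).eval z -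
      beta n α τ ζ s n * (poly n α τ ζ s p₀ n).eval z) * hs
  | cast j =>
    simp only [A_conjTranspose_mulVec_castSucc, polyVec, Fin.val_castSucc, Fin.val_succ,
      Pi.single_eq_of_ne (Fin.castSucc_lt_last j).ne, smul_zero]
    linear_combination ((poly n α τ ζ s p₀ (j + 1)).eval z -
      beta n α τ ζ s j * (poly n α τ ζ s p₀ j).eval z) * hs

theorem hasDerivAt_polyVec (z : ℂ) :
    HasDerivAt (polyVec n α τ ζ s p₀)
      (fun j => (derivative (poly n α τ ζ s p₀ j)).eval z) z :=
  hasDerivAt_pi.mpr fun _ => Polynomial.hasDerivAt _ _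

theorem Admissible.pencil_mulVec_derivative (h : Admissible n α τ ζ s) (z : ℂ) :
    (conj ζ * z) • A n α τ ζ s *ᵥ (fun j => (derivative (poly n α τ ζ s p₀ j)).eval z) +
      (A n α τ ζ s)ᴴ *ᵥ (fun j => (derivative (poly n α τ ζ s p₀ j)).eval z) +
      conj ζ • A n α τ ζ s *ᵥ polyVec n α τ ζ s p₀ z =
      (derivative (poly n α τ ζ s p₀ (n + 1))).eval z • Pi.single (Fin.last n) (conj s) := by
  have hmulVec (M : Matrix (Fin (n + 1)) (Fin (n + 1)) ℂ) :
      HasDerivAt (fun z => M *ᵥ polyVec n α τ ζ s p₀ z)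
        (M *ᵥ fun j => (derivative (poly n α τ ζ s p₀ j)).eval z) z :=
    M.mulVecLin.toContinuousLinearMap.hasFDerivAt.comp_hasDerivAt z (hasDerivAt_polyVec z)
  have hscalar : HasDerivAt (fun z => conj ζ * z) (conj ζ) z := hasDerivAt_const_mul _
  have hleft := (hscalar.smul (hmulVec (A n α τ ζ s))).add (hmulVec (A n α τ ζ s)ᴴ)
  have hright := ((poly n α τ ζ s p₀ (n + 1)).hasDerivAt z).smul_const
    (Pi.single (M := fun _ : Fin (n + 1) => ℂ) (Fin.last n) (conj s))
  rw [add_right_comm]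
  exact hleft.unique (hright.congr_of_eventuallyEq (.of_forall fun z => h.pencil_mulVec_polyVec z))

theorem Admissible.pencil_mulVec_polyVec_of_isRoot (h : Admissible n α τ ζ s)
    (hz : (poly n α τ ζ s p₀ (n + 1)).IsRoot z) :
    (conj ζ * z) • A n α τ ζ s *ᵥ polyVec n α τ ζ s p₀ z +
      (A n α τ ζ s)ᴴ *ᵥ polyVec n α τ ζ s p₀ z = 0 := by
  rw [h.pencil_mulVec_polyVec, hz.eq_zero, zero_smul]

namespace Regular

theorem natDegree_poly (h : Regular n α τ ζ s) (hp : p₀ ≠ 0) (hj : j ≤ n + 1) :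
    (poly n α τ ζ s p₀ j).natDegree = j := by
  refine natDegree_eq_of_le_of_coeff_ne_zero (natDegree_poly_le ..) ?_
  rw [coeff_poly_self]
  refine mul_ne_zero (Complex.ofReal_ne_zero.mpr hp) (Finset.prod_ne_zero_iff.mpr fun i hi => ?_)
  exact (_root_.map_ne_zero _).mpr (h.beta_ne_zero (by have := Finset.mem_range.mp hi; omega))

theorem poly_succ_ne_zero (h : Regular n α τ ζ s) (hp : p₀ ≠ 0) :
    poly n α τ ζ s p₀ (n + 1) ≠ 0 :=
  ne_zero_of_natDegree_gt (n := 0) (by rw [h.natDegree_poly hp le_rfl]; omega)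

theorem norm_eq_one_of_isRoot_poly (h : Regular n α τ ζ s) (hp : p₀ ≠ 0)
    (hz : (poly n α τ ζ s p₀ (n + 1)).IsRoot z) : ‖z‖ = 1 := by
  have hw := norm_eq_one_of_pencil h.A_add_conjTranspose_posDef (polyVec_ne_zero hp z)
    (h.pencil_mulVec_polyVec_of_isRoot hz)
  rwa [norm_mul, Complex.norm_conj, h.norm_base, one_mul] at hw

theorem conj_base_mul_ne_one_of_isRoot_poly (h : Regular n α τ ζ s) (hp : p₀ ≠ 0)
    (hz : (poly n α τ ζ s p₀ (n + 1)).IsRoot z) : conj ζ * z ≠ 1 :=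
  ne_one_of_pencil h.A_add_conjTranspose_posDef (polyVec_ne_zero hp z)
    (h.pencil_mulVec_polyVec_of_isRoot hz)

theorem nodup_roots_poly (h : Regular n α τ ζ s) (hp : p₀ ≠ 0) :
    (poly n α τ ζ s p₀ (n + 1)).roots.Nodup := by
  refine Multiset.nodup_iff_count_le_one.mpr fun z => not_lt.mp fun hlt => ?_
  rw [count_roots] at hlt
  obtain ⟨hz, hz'⟩ := (one_lt_rootMultiplicity_iff_isRoot (h.poly_succ_ne_zero hp)).mp hlt
  have hchain := h.pencil_mulVec_derivative (p₀ := p₀) z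
  rw [hz'.eq_zero, zero_smul] at hchain
  have hζ : conj ζ = 0 := eq_zero_of_pencil_chain h.A_add_conjTranspose_posDef
    (polyVec_ne_zero hp z) (h.pencil_mulVec_polyVec_of_isRoot hz) hchain
  simpa [hζ] using h.conj_base_mul

end Regular

end Polynomials

section Szego

/-- The number `ρ = (1 - |a|^2)^{1/2}` attached to a coefficient `a`, as a complex number. -/
def rho (a : ℂ) : ℂ := (Real.sqrt (1 - ‖a‖ ^ 2) : ℝ)

theorem rho_mul_self {a : ℂ} (ha : ‖a‖ < 1) : rho a * rho a = 1 - conj a * a := by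
  rw [rho, ← Complex.ofReal_mul, Real.mul_self_sqrt (by nlinarith [norm_nonneg a]),
    Complex.conj_mul']
  push_cast
  rfl

theorem rho_ne_zero {a : ℂ} (ha : ‖a‖ < 1) : rho a ≠ 0 := by
  rw [rho, Complex.ofReal_ne_zero]
  exact (Real.sqrt_pos.mpr (by nlinarith [norm_nonneg a])).ne'

/-- The product `G_0 ⋯ G_{k-1}`. -/
def partialProd (n : ℕ) (α : ℕ → ℂ) (k : ℕ) : Matrix (Fin (n + 1)) (Fin (n + 1)) ℂ :=
  ((List.range k).map fun j => rotFactor n j (α j)).prod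

theorem partialProd_succ (n : ℕ) (α : ℕ → ℂ) (k : ℕ) :
    partialProd n α (k + 1) = partialProd n α k * rotFactor n k (α k) := by
  simp [partialProd, List.range_succ]

/-- The entry in column `k` of the row vector `v G_0 ⋯ G_{k-1}`: the only entry of this product
that the remaining factors `G_k, G_{k+1}, …` change and that is not an entry of `v`. -/
def carry (α v : ℕ → ℂ) : ℕ → ℂ
  | 0 => v 0
  | k + 1 => carry α v k * rho (α k) - v (k + 1) * α k

theorem vecMul_rotFactor (hj : j < n) (a : ℂ) (v : ℕ → ℂ) :
    (fun i : Fin (n + 1) => v i) ᵥ* rotFactor n j a = fun c : Fin (n + 1) =>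
      if c.val = j then v j * conj a + v (j + 1) * rho a
      else if c.val = j + 1 then v j * rho a - v (j + 1) * a else v c := by
  have hcolumn (c : Fin (n + 1)) (hc : c.val = j ∨ c.val = j + 1) :
      ((fun i : Fin (n + 1) => v i) ᵥ* rotFactor n j a) c =
        v j * rotFactor n j a ⟨j, by omega⟩ c +
          v (j + 1) * rotFactor n j a ⟨j + 1, by omega⟩ c := by
    refine Fintype.sum_eq_add (⟨j, by omega⟩ : Fin (n + 1)) ⟨j + 1, by omega⟩ (by simp)
      fun r hr => ?_
    simp only [ne_eq, Fin.ext_iff] at hr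
    have hrc : r ≠ c := by rintro rfl; tauto
    simp [rotFactor, hr, hrc]
  ext c
  split_ifs with hj hj'
  · rw [hcolumn c (.inl hj)]
    simp [rotFactor, hj, rho]
  · rw [hcolumn c (.inr hj')]
    simp [rotFactor, hj', rho, sub_eq_add_neg]
  · refine (Fintype.sum_eq_single c fun r hr => ?_).trans ?_
    · simp [rotFactor, hj, hj', hr]
    · simp [rotFactor, hj, hj']

theorem vecMul_partialProd (v : ℕ → ℂ) {k : ℕ} (hk : k ≤ n) :
    (fun i : Fin (n + 1) => v i) ᵥ* partialProd n α k = fun c : Fin (n + 1) =>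
      if c.val < k then carry α v c * conj (α c) + v (c + 1) * rho (α c)
      else if c.val = k then carry α v k else v c := by
  induction k with
  | zero =>
    ext c
    simp only [partialProd, List.range_zero, List.map_nil, List.prod_nil, Matrix.vecMul_one,
      Nat.not_lt_zero, if_false]
    split_ifs with hc
    · rw [hc, carry]
    · rfl
  | succ k ih =>
    rw [partialProd_succ, ← Matrix.vecMul_vecMul, ih (by omega),
      vecMul_rotFactor (by omega) (α k) fun i =>
        if i < k then carry α v i * conj (α i) + v (i + 1) * rho (α i)
        else if i = k then carry α v k else v i]
    ext c
    simp only [lt_irrefl, if_false, if_true, show ¬ k + 1 < k by omega, show ¬ k + 1 = k by omega]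
    grind [carry]

theorem vecMul_G (v : ℕ → ℂ) (c : Fin (n + 1)) :
    ((fun i : Fin (n + 1) => v i) ᵥ* G n α τ) c =
      if c.val < n then carry α v c * conj (α c) + v (c + 1) * rho (α c)
      else carry α v n * conj τ := by
  change (_ ᵥ* (partialProd n α n * lastFactor n τ)) c = _
  rw [← Matrix.vecMul_vecMul, vecMul_partialProd v le_rfl, lastFactor, Matrix.vecMul_diagonal]
  grind

theorem G_zero_apply (n : ℕ) (α : ℕ → ℂ) (τ : ℂ) (c : Fin (n + 1)) :
    G n α τ 0 c = (∏ l ∈ Finset.range c, rho (α l)) * conj (if c.val < n then α c else τ) := by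
  have hcarry (k : ℕ) : carry α (Pi.single 0 1) k = ∏ l ∈ Finset.range k, rho (α l) := by
    induction k with
    | zero => simp [carry]
    | succ k ih => rw [carry, ih, Finset.prod_range_succ]; simp
  have hsingle : (fun i : Fin (n + 1) => (Pi.single 0 1 : ℕ → ℂ) i) = Pi.single 0 1 := by
    ext i
    simp [Pi.single_apply]
  have hrow : G n α τ 0 c = ((Pi.single 0 1 : Fin (n + 1) → ℂ) ᵥ* G n α τ) c := by
    rw [Matrix.single_one_vecMul]; rfl
  rw [hrow, ← hsingle, vecMul_G, hcarry, hcarry]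
  split_ifs with hc
  · simp
  · rw [show c.val = n by omega]

/-- The pair `(φ_j(z), φ_j^*(z))` of the orthonormal polynomial of degree `j` on the unit circle
with coefficients `α` and of its reversed polynomial. -/
def szego (α : ℕ → ℂ) (z : ℂ) : ℕ → ℂ × ℂ
  | 0 => (1, 1)
  | j + 1 => ((z * (szego α z j).1 - conj (α j) * (szego α z j).2) / rho (α j),
      ((szego α z j).2 - α j * (z * (szego α z j).1)) / rho (α j))

theorem szego_succ_fst_mul (hj : ‖α j‖ < 1) (z : ℂ) :
    (szego α z (j + 1)).1 * rho (α j) = z * (szego α z j).1 - conj (α j) * (szego α z j).2 := by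
  rw [szego]; exact div_mul_cancel₀ _ (rho_ne_zero hj)

theorem szego_succ_snd_mul (hj : ‖α j‖ < 1) (z : ℂ) :
    (szego α z (j + 1)).2 * rho (α j) = (szego α z j).2 - α j * (z * (szego α z j).1) := by
  rw [szego]; exact div_mul_cancel₀ _ (rho_ne_zero hj)

theorem carry_szego (hα : ∀ j < n, ‖α j‖ < 1) (z : ℂ) {k : ℕ} (hk : k ≤ n) :
    carry α (fun j => (szego α z j).1) k = (szego α z k).2 := by
  induction k with
  | zero => simp [carry, szego]
  | succ k ih =>
    have hk := hα k (by omega)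
    rw [carry, ih (by omega)]
    apply mul_right_cancel₀ (rho_ne_zero hk)
    linear_combination (szego α z k).2 * rho_mul_self hk - α k * szego_succ_fst_mul hk z -
      szego_succ_snd_mul hk z

theorem szego_vecMul_G (hα : ∀ j < n, ‖α j‖ < 1) {z : ℂ}
    (hz : z * (szego α z n).1 = conj τ * (szego α z n).2) :
    (fun i : Fin (n + 1) => (szego α z i).1) ᵥ* G n α τ =
      z • fun i : Fin (n + 1) => (szego α z i).1 := by
  ext c
  rw [vecMul_G (fun j => (szego α z j).1), Pi.smul_apply, smul_eq_mul,
    carry_szego hα z (Fin.is_le c), carry_szego hα z le_rfl]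
  split_ifs with hc
  · linear_combination szego_succ_fst_mul (hα c hc) z
  · rw [show c.val = n by omega, hz, mul_comm]

theorem isEigenvalue_iff_isRoot_charpoly {m : ℕ} (M : Matrix (Fin m) (Fin m) ℂ) (z : ℂ) :
    IsEigenvalue M z ↔ M.charpoly.IsRoot z := by
  rw [IsEigenvalue, Module.End.hasEigenvalue_iff_isRoot_charpoly, Matrix.charpoly_toLin']

theorem isEigenvalue_of_vecMul {m : ℕ} {M : Matrix (Fin m) (Fin m) ℂ} {z : ℂ} {v : Fin m → ℂ}
    (hv : v ≠ 0) (h : v ᵥ* M = z • v) : IsEigenvalue M z := by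
  rw [isEigenvalue_iff_isRoot_charpoly, Polynomial.IsRoot, Matrix.eval_charpoly,
    ← Matrix.exists_vecMul_eq_zero_iff]
  refine ⟨v, hv, ?_⟩
  rw [Matrix.vecMul_sub, h, sub_eq_zero]
  ext i
  simp [Matrix.scalar_apply, Matrix.vecMul_diagonal, mul_comm]

/-- The combination `w φ_j(z) - conj τ_j(ζ) φ_j^*(z)`. For `w = z` and `j = n` it is the
para-orthogonal polynomial whose zeros are the eigenvalues of `G`. -/
def paraSzego (n : ℕ) (α : ℕ → ℂ) (τ ζ w z : ℂ) (j : ℕ) : ℂ :=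
  w * (szego α z j).1 - conj (pseudo n α τ ζ j) * (szego α z j).2

namespace Admissible

theorem isEigenvalue_of_paraSzego (h : Admissible n α τ ζ s) {z : ℂ}
    (hz : paraSzego n α τ ζ z z n = 0) : IsEigenvalue (G n α τ) z := by
  rw [paraSzego, pseudo_of_le le_rfl, sub_eq_zero] at hz
  refine isEigenvalue_of_vecMul (fun hzero => ?_) (szego_vecMul_G h.norm_coeff hz)
  simpa [szego] using congrFun hzero 0

theorem conj_pseudo_rec (h : Admissible n α τ ζ s) (hj : j < n) :
    conj (pseudo n α τ ζ j) * (ζ + conj (pseudo n α τ ζ (j + 1)) * α j) =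
      ζ * conj (α j) + conj (pseudo n α τ ζ (j + 1)) := by
  have hrec := congrArg (starRingEnd ℂ) (h.pseudo_rec hj)
  simp only [map_mul, map_add, Complex.conj_conj] at hrec
  linear_combination hrec

theorem rho_mul_paraSzego_base_succ (h : Admissible n α τ ζ s) (hj : j < n) (z : ℂ) :
    rho (α j) * paraSzego n α τ ζ ζ z (j + 1) =
      (ζ + conj (pseudo n α τ ζ (j + 1)) * α j) * paraSzego n α τ ζ z z j := by
  simp only [paraSzego]
  linear_combination ζ * szego_succ_fst_mul (h.norm_coeff j hj) z -
    conj (pseudo n α τ ζ (j + 1)) * szego_succ_snd_mul (h.norm_coeff j hj) z +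
    (szego α z j).2 * h.conj_pseudo_rec hj

theorem isEigenvalue_base (h : Admissible n α τ ζ s) (hζ : pseudo n α τ ζ 0 * ζ = 1) :
    IsEigenvalue (G n α τ) ζ := by
  suffices hpara : ∀ j ≤ n, paraSzego n α τ ζ ζ ζ j = 0 from
    h.isEigenvalue_of_paraSzego (hpara n le_rfl)
  intro j hj
  induction j with
  | zero =>
    simp only [paraSzego, szego]
    linear_combination conj (pseudo n α τ ζ 0) * hζ - ζ * h.conj_pseudo_mul 0
  | succ j ih =>
    have hrec := h.rho_mul_paraSzego_base_succ (j := j) (by omega) ζ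
    rw [ih (by omega), mul_zero] at hrec
    exact (mul_eq_zero.mp hrec).resolve_left (rho_ne_zero (h.norm_coeff j (by omega)))

theorem regular (h : Admissible n α τ ζ s) (hζ : ¬ IsEigenvalue (G n α τ) ζ) :
    Regular n α τ ζ s :=
  { h with pseudo_mul_base_ne := fun h0 => hζ (h.isEigenvalue_base h0) }

end Admissible

/-- The ratio of `p_{j+1}(z, ζ)` to `z φ_j(z) - conj τ_j(ζ) φ_j^*(z)`. -/
def szegoScale (n : ℕ) (α : ℕ → ℂ) (τ ζ s : ℂ) (p₀ : ℝ) (j : ℕ) : ℂ :=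
  p₀ * (∏ i ∈ Finset.range (j + 1), conj (beta n α τ ζ s i)) * ∏ i ∈ Finset.range j, rho (α i)

theorem szegoScale_succ (n : ℕ) (α : ℕ → ℂ) (τ ζ s : ℂ) (p₀ : ℝ) (j : ℕ) :
    szegoScale n α τ ζ s p₀ (j + 1) =
      szegoScale n α τ ζ s p₀ j * conj (beta n α τ ζ s (j + 1)) * rho (α j) := by
  simp only [szegoScale, Finset.prod_range_succ]
  ring

namespace Regular

variable {p₀ : ℝ} {z : ℂ}

theorem szegoScale_ne_zero (h : Regular n α τ ζ s) (hp : p₀ ≠ 0) :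
    szegoScale n α τ ζ s p₀ n ≠ 0 := by
  refine mul_ne_zero (mul_ne_zero (Complex.ofReal_ne_zero.mpr hp) ?_) ?_ <;>
    refine Finset.prod_ne_zero_iff.mpr fun i hi => ?_ <;> rw [Finset.mem_range] at hi
  · exact (map_ne_zero _).mpr (h.beta_ne_zero (by omega))
  · exact rho_ne_zero (h.norm_coeff i hi)

theorem conj_beta_succ_mul_pivot (h : Regular n α τ ζ s) (hj : j < n) :
    conj (beta n α τ ζ s (j + 1)) * conj s * (ζ + conj (pseudo n α τ ζ (j + 1)) * α j) =
      pivot n α τ ζ (j + 1) := by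
  simpa [prevCoeff] using congrArg (starRingEnd ℂ) (h.beta_mul (j := j + 1) hj)

theorem pivot_mul_paraSzego_succ (h : Regular n α τ ζ s) (hj : j < n) (z : ℂ) :
    pivot n α τ ζ j * (conj (beta n α τ ζ s (j + 1)) * rho (α j) *
        paraSzego n α τ ζ z z (j + 1)) =
      pivot n α τ ζ j * ((beta n α τ ζ s (j + 1) + conj (beta n α τ ζ s (j + 1)) * z) *
        paraSzego n α τ ζ z z j) - z * (conj s * paraSzego n α τ ζ ζ z j) := by
  have hs : conj s * ζ = s := by
    linear_combination (-conj s) * h.sq_root + s * h.conj_root_mul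
  have hα := h.norm_coeff j hj
  simp only [paraSzego]
  linear_combination pivot n α τ ζ j * conj (beta n α τ ζ s (j + 1)) *
      (z * szego_succ_fst_mul hα z - conj (pseudo n α τ ζ (j + 1)) * szego_succ_snd_mul hα z) -
    z * (szego α z j).1 * (h.beta_succ_mul hj +
      pivot n α τ ζ j * α j * h.beta_succ_mul_conj_pseudo hj - hs) +
    (szego α z j).2 * (pivot n α τ ζ j * h.beta_succ_mul_conj_pseudo hj +
      z * (conj (pseudo n α τ ζ j) * h.conj_beta_succ_mul hj +
        conj (beta n α τ ζ s (j + 1)) * pivot n α τ ζ j * conj (α j) * h.conj_pseudo_mul j))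

theorem eval_poly_mul_pivot_and_eval_poly_succ (h : Regular n α τ ζ s) (z : ℂ) (hj : j ≤ n) :
    (poly n α τ ζ s p₀ j).eval z * pivot n α τ ζ j =
      szegoScale n α τ ζ s p₀ j * (conj s * paraSzego n α τ ζ ζ z j) ∧
    (poly n α τ ζ s p₀ (j + 1)).eval z =
      szegoScale n α τ ζ s p₀ j * paraSzego n α τ ζ z z j := by
  induction j with
  | zero =>
    simp only [poly, pivot, szegoScale, paraSzego, szego, Polynomial.eval_mul, Polynomial.eval_add,
      Polynomial.eval_C, Polynomial.eval_X, zero_add, Finset.prod_range_one,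
      Finset.prod_range_zero, Complex.ofReal_one]
    constructor
    · linear_combination (-(p₀ : ℂ)) * h.conj_beta_zero_mul + p₀ * conj (beta n α τ ζ s 0) *
        (conj s * h.sq_root - s * h.conj_root_mul)
    · linear_combination (p₀ : ℂ) * h.beta_zero_eq
  | succ j ih =>
    obtain ⟨hpivot, hpoly⟩ := ih (by omega)
    constructor
    · rw [hpoly, szegoScale_succ]
      linear_combination (-szegoScale n α τ ζ s p₀ j * paraSzego n α τ ζ z z j) *
          h.conj_beta_succ_mul_pivot hj -
        szegoScale n α τ ζ s p₀ j * conj (beta n α τ ζ s (j + 1)) * conj s *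
          h.rho_mul_paraSzego_base_succ hj z
    · apply mul_left_cancel₀ (h.pivot_ne_zero (j := j) (by omega))
      rw [szegoScale_succ, poly]
      simp only [Polynomial.eval_mul, Polynomial.eval_add, Polynomial.eval_sub, Polynomial.eval_C,
        Polynomial.eval_X]
      rw [hpoly]
      linear_combination (-szegoScale n α τ ζ s p₀ j) * h.pivot_mul_paraSzego_succ hj z -
        z * hpivot

theorem isEigenvalue_of_isRoot_poly (h : Regular n α τ ζ s) (hp : p₀ ≠ 0)
    (hz : (poly n α τ ζ s p₀ (n + 1)).IsRoot z) : IsEigenvalue (G n α τ) z := by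
  rw [Polynomial.IsRoot.def, (h.eval_poly_mul_pivot_and_eval_poly_succ z le_rfl).2] at hz
  exact h.isEigenvalue_of_paraSzego ((mul_eq_zero.mp hz).resolve_left (h.szegoScale_ne_zero hp))

theorem roots_poly_eq_roots_charpoly (h : Regular n α τ ζ s) (hp : p₀ ≠ 0) :
    (poly n α τ ζ s p₀ (n + 1)).roots = (G n α τ).charpoly.roots := by
  apply Multiset.eq_of_le_of_card_le
  · refine (Multiset.le_iff_subset (h.nodup_roots_poly hp)).mpr fun z hz => ?_
    rw [Polynomial.mem_roots (h.poly_succ_ne_zero hp)] at hz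
    rw [Polynomial.mem_roots (Matrix.charpoly_monic _).ne_zero, ← isEigenvalue_iff_isRoot_charpoly]
    exact h.isEigenvalue_of_isRoot_poly hp hz
  · calc (G n α τ).charpoly.roots.card ≤ (G n α τ).charpoly.natDegree := Polynomial.card_roots' _
      _ = n + 1 := by rw [Matrix.charpoly_natDegree_eq_dim, Fintype.card_fin]
      _ = (poly n α τ ζ s p₀ (n + 1)).natDegree := (h.natDegree_poly hp le_rfl).symm
      _ = (poly n α τ ζ s p₀ (n + 1)).roots.card :=
        (IsAlgClosed.splits _).natDegree_eq_card_roots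

theorem isEigenvalue_iff_isRoot_poly (h : Regular n α τ ζ s) (hp : p₀ ≠ 0) (z : ℂ) :
    IsEigenvalue (G n α τ) z ↔ (poly n α τ ζ s p₀ (n + 1)).IsRoot z := by
  rw [isEigenvalue_iff_isRoot_charpoly, ← Polynomial.mem_roots (Matrix.charpoly_monic _).ne_zero,
    ← h.roots_poly_eq_roots_charpoly hp, Polynomial.mem_roots (h.poly_succ_ne_zero hp)]

end Regular

end Szego

section Cayley

theorem rootH_mul_self (hH : (H n α τ ζ s).PosDef) :
    rootH n α τ ζ s * rootH n α τ ζ s = H n α τ ζ s :=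
  CFC.sqrt_mul_sqrt_self _ hH.posSemidef.nonneg

theorem rootH_posDef (hH : (H n α τ ζ s).PosDef) : (rootH n α τ ζ s).PosDef :=
  posDef_sqrt hH

theorem quadForm_mul_mul {m : ℕ} {R : Matrix (Fin m) (Fin m) ℂ} (hR : R.IsHermitian)
    (M : Matrix (Fin m) (Fin m) ℂ) (x : Fin m → ℂ) :
    quadForm (R * M * R) x = quadForm M (R *ᵥ x) := by
  rw [quadForm, quadForm, Matrix.star_mulVec, hR.eq, ← Matrix.dotProduct_mulVec,
    Matrix.mulVec_mulVec, Matrix.mulVec_mulVec, Matrix.mul_assoc]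

theorem quadForm_H (hH : (H n α τ ζ s).PosDef) (x : Fin (n + 1) → ℂ) :
    quadForm (H n α τ ζ s) x = star (rootH n α τ ζ s *ᵥ x) ⬝ᵥ (rootH n α τ ζ s *ᵥ x) := by
  have h := quadForm_mul_mul (rootH_posDef hH).isHermitian 1 x
  rwa [Matrix.mul_one, rootH_mul_self hH, quadForm, quadForm, Matrix.one_mulVec] at h

theorem K_isHermitian (n : ℕ) (α : ℕ → ℂ) (τ ζ s : ℂ) : (K n α τ ζ s).IsHermitian := by
  rw [Matrix.IsHermitian, K, Matrix.conjTranspose_smul, Matrix.conjTranspose_sub,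
    Matrix.conjTranspose_conjTranspose, ← neg_sub (A n α τ ζ s), smul_neg, ← neg_smul]
  congr 1
  simp

theorem cayley_isHermitian (hH : (H n α τ ζ s).PosDef) : (cayley n α τ ζ s).IsHermitian := by
  rw [Matrix.IsHermitian, cayley, Matrix.conjTranspose_mul, Matrix.conjTranspose_mul,
    Matrix.conjTranspose_nonsing_inv, (rootH_posDef hH).isHermitian.eq, (K_isHermitian ..).eq,
    Matrix.mul_assoc]

theorem rootH_mulVec_ne_zero (hH : (H n α τ ζ s).PosDef) {x : Fin (n + 1) → ℂ} (hx : x ≠ 0) :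
    rootH n α τ ζ s *ᵥ x ≠ 0 := fun h =>
  hx (Matrix.mulVec_injective_of_isUnit (rootH_posDef hH).isUnit
    (h.trans (Matrix.mulVec_zero _).symm))

namespace Regular

variable {p₀ : ℝ} {z : ℂ}

theorem cayley_mulVec (h : Regular n α τ ζ s) (hp : p₀ ≠ 0)
    (hz : (poly n α τ ζ s p₀ (n + 1)).IsRoot z) :
    cayley n α τ ζ s *ᵥ (rootH n α τ ζ s *ᵥ polyVec n α τ ζ s p₀ z) =
      cayleyValue (conj ζ * z) • rootH n α τ ζ s *ᵥ polyVec n α τ ζ s p₀ z := by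
  refine sandwich_inv_mulVec (rootH_posDef h.H_posDef).isUnit ?_
  rw [rootH_mul_self h.H_posDef]
  exact mulVec_eq_cayleyValue_smul (h.pencil_mulVec_polyVec_of_isRoot hz)
    (h.conj_base_mul_ne_one_of_isRoot_poly hp hz)

theorem norm_eq_one_of_isEigenvalue (h : Regular n α τ ζ s) (hz : IsEigenvalue (G n α τ) z) :
    ‖z‖ = 1 :=
  h.norm_eq_one_of_isRoot_poly one_ne_zero ((h.isEigenvalue_iff_isRoot_poly one_ne_zero z).mp hz)

theorem eval_derivative_charpoly_ne_zero (h : Regular n α τ ζ s)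
    (hz : IsEigenvalue (G n α τ) z) : (G n α τ).charpoly.derivative.eval z ≠ 0 := by
  intro hz'
  have hcount := Multiset.nodup_iff_count_le_one.mp (h.nodup_roots_poly one_ne_zero) z
  rw [h.roots_poly_eq_roots_charpoly one_ne_zero, Polynomial.count_roots] at hcount
  exact hcount.not_gt ((Polynomial.one_lt_rootMultiplicity_iff_isRoot
    (Matrix.charpoly_monic _).ne_zero).mpr ⟨(isEigenvalue_iff_isRoot_charpoly _ _).mp hz, hz'⟩)

end Regular

end Cayley

section Curve

theorem differentiableAt_rho {E : Type*} [NormedAddCommGroup E] [NormedSpace ℝ E] {f : E → ℂ}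
    {t : E} (hf : DifferentiableAt ℝ f t) (ht : ‖f t‖ < 1) :
    DifferentiableAt ℝ (fun u => rho (f u)) t := by
  have hsqrt : DifferentiableAt ℝ (fun u => Real.sqrt (1 - ‖f u‖ ^ 2)) t :=
    ((hf.norm_sq ℝ).const_sub 1).sqrt (by nlinarith [norm_nonneg (f t)])
  exact Complex.ofRealCLM.differentiableAt.comp t hsqrt

variable {α : ℝ → ℕ → ℂ} {τ : ℝ → ℂ} {t : ℝ}

theorem differentiableAt_coeff (hα : ∀ j < n, ‖α t j‖ < 1)
    (hG : ∀ i j, DifferentiableAt ℝ (fun u => G n (α u) (τ u) i j) t) (hj : j ≤ n) :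
    DifferentiableAt ℝ (fun u => if j < n then α u j else τ u) t := by
  induction j using Nat.strong_induction_on with
  | _ j ih =>
    have hrho : ∀ l ∈ Finset.range j, DifferentiableAt ℝ (fun u => rho (α u l)) t := by
      intro l hl
      have hlj := Finset.mem_range.mp hl
      have hl' := ih l hlj (hlj.le.trans hj)
      simp only [hlj.trans_le hj, if_true] at hl'
      exact differentiableAt_rho hl' (hα l (hlj.trans_le hj))
    have hprod : DifferentiableAt ℝ (fun u => ∏ l ∈ Finset.range j, rho (α u l)) t := by
      simpa only [Finset.prod_fn] using DifferentiableAt.finsetProd hrho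
    have hne : ∏ l ∈ Finset.range j, rho (α t l) ≠ 0 :=
      Finset.prod_ne_zero_iff.mpr fun l hl =>
        rho_ne_zero (hα l ((Finset.mem_range.mp hl).trans_le hj))
    refine ((hG 0 ⟨j, Nat.lt_succ_of_le hj⟩).fun_div hprod hne).star.congr_of_eventuallyEq ?_
    filter_upwards [hprod.continuousAt.eventually_ne hne] with u hu
    rw [G_zero_apply, mul_div_cancel_left₀ _ hu, ← starRingEnd_apply, Complex.conj_conj]

theorem differentiableAt_pseudo (h : Admissible n (α t) (τ t) ζ s)
    (hG : ∀ i j, DifferentiableAt ℝ (fun u => G n (α u) (τ u) i j) t) (j : ℕ) :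
    DifferentiableAt ℝ (fun u => pseudo n (α u) (τ u) ζ j) t := by
  by_cases hj : j < n
  · have hsucc := differentiableAt_pseudo h hG (j + 1)
    have hα := differentiableAt_coeff h.norm_coeff hG hj.le
    simp only [hj, if_true] at hα
    simp only [pseudo_of_lt hj]
    exact ((hα.const_mul _).add hsucc).fun_div ((hα.star.mul hsucc).add_const _)
      (h.pseudo_den_ne_zero hj (h.norm_pseudo _))
  · simpa only [pseudo_of_le (not_lt.mp hj), lt_irrefl, if_false] using
      differentiableAt_coeff h.norm_coeff hG le_rfl
termination_by n - j

theorem differentiableAt_beta (h : Regular n (α t) (τ t) ζ s)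
    (hG : ∀ i j, DifferentiableAt ℝ (fun u => G n (α u) (τ u) i j) t) (hj : j ≤ n) :
    DifferentiableAt ℝ (fun u => beta n (α u) (τ u) ζ s j) t := by
  have hpseudo := differentiableAt_pseudo h.toAdmissible hG
  have hα {j : ℕ} (hj : j < n) : DifferentiableAt ℝ (fun u => α u j) t := by
    simpa only [hj, if_true] using differentiableAt_coeff h.norm_coeff hG hj.le
  induction j with
  | zero =>
    exact (differentiableAt_const _).fun_div (((hpseudo 0).mul_const s).const_sub _)
      h.beta_zero_den_ne_zero
  | succ j ih =>
    have hprev : DifferentiableAt ℝ (fun u => prevCoeff (α u) j) t := by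
      cases j with
      | zero => exact differentiableAt_const _
      | succ j => exact hα (Nat.lt_of_succ_lt hj)
    have hden : conj ζ + pseudo n (α t) (τ t) ζ j * conj (prevCoeff (α t) j) ≠ 0 := fun h0 =>
      h.pivot_ne_zero (Nat.le_of_succ_le hj)
        (by rw [← h.beta_mul (Nat.le_of_succ_le hj), h0, mul_zero])
    have hfactor : 1 - conj (pseudo n (α t) (τ t) ζ j) * α t j ≠ 0 := by
      rw [mul_comm]
      exact h.factor_ne_zero hj
    simp only [beta]
    exact (((differentiableAt_const _).fun_div (ih (Nat.le_of_succ_le hj))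
        (h.beta_ne_zero (Nat.le_of_succ_le hj))).mul
      ((differentiableAt_const _).fun_div (((hpseudo j).mul hprev.star).const_add _) hden)).mul
      ((differentiableAt_const _).fun_div (((hpseudo j).star.mul (hα hj)).const_sub _) hfactor)

theorem differentiableAt_A (h : Regular n (α t) (τ t) ζ s)
    (hG : ∀ i j, DifferentiableAt ℝ (fun u => G n (α u) (τ u) i j) t) :
    DifferentiableAt ℝ (fun u => A n (α u) (τ u) ζ s) t := by
  refine differentiableAt_matrix_iff.mpr fun r c => ?_
  simp only [A_apply]
  refine DifferentiableAt.add_const _ ?_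
  split_ifs
  · exact (differentiableAt_beta h hG r.is_le).star.const_mul _
  · exact differentiableAt_const _

theorem eventually_regular (hadm : ∀ᶠ u in 𝓝 t, Admissible n (α u) (τ u) ζ s)
    (hG : ∀ i j, DifferentiableAt ℝ (fun u => G n (α u) (τ u) i j) t)
    (hζ : ¬ IsEigenvalue (G n (α t) (τ t)) ζ) :
    ∀ᶠ u in 𝓝 t, Regular n (α u) (τ u) ζ s := by
  have hpseudo := (differentiableAt_pseudo hadm.self_of_nhds hG 0).continuousAt.mul_const ζ
  filter_upwards [hadm,
    hpseudo.eventually_ne (hadm.self_of_nhds.regular hζ).pseudo_mul_base_ne] with u hu hne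
  exact ⟨hu, hne⟩

theorem continuousAt_polyVec {z : ℝ → ℂ} (h : Regular n (α t) (τ t) ζ s)
    (hG : ∀ i j, DifferentiableAt ℝ (fun u => G n (α u) (τ u) i j) t) (hz : ContinuousAt z t)
    (p₀ : ℝ) : ContinuousAt (fun u => polyVec n (α u) (τ u) ζ s p₀ (z u)) t := by
  have hfactor {j : ℕ} (hj : j ≤ n) : ContinuousAt
      (fun u => beta n (α u) (τ u) ζ s j + conj (beta n (α u) (τ u) ζ s j) * z u) t := by
    have hβ := (differentiableAt_beta h hG hj).continuousAt
    exact hβ.add (hβ.star.mul hz)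
  have heval (j : ℕ) (hj : j ≤ n) :
      ContinuousAt (fun u => (poly n (α u) (τ u) ζ s p₀ j).eval (z u)) t := by
    induction j using Nat.twoStepInduction with
    | zero => simpa only [poly, Polynomial.eval_C] using continuousAt_const
    | one =>
      simpa [poly] using (hfactor n.zero_le).fun_mul continuousAt_const
    | more j ih ih' =>
      simpa [poly] using ((hfactor (Nat.le_of_succ_le hj)).fun_mul
        (ih' (Nat.le_of_succ_le hj))).fun_sub (hz.fun_mul (ih (by omega)))
  exact continuousAt_pi.mpr fun j => heval j j.is_le

section L2Operator

open scoped Matrix.Norms.L2Operator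

variable (hreg : ∀ᶠ u in 𝓝 t, Regular n (α u) (τ u) ζ s)
  (hG : ∀ i j, DifferentiableAt ℝ (fun u => G n (α u) (τ u) i j) t)

include hreg hG

theorem differentiableAt_rootH : DifferentiableAt ℝ (fun u => rootH n (α u) (τ u) ζ s) t := by
  have hA := differentiableAt_A hreg.self_of_nhds hG
  exact differentiableAt_sqrt ((hA.fun_add hA.star).fun_const_smul _)
    (hreg.mono fun u hu => hu.H_posDef)

theorem differentiableAt_cayley : DifferentiableAt ℝ (fun u => cayley n (α u) (τ u) ζ s) t := by
  have hA := differentiableAt_A hreg.self_of_nhds hG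
  exact differentiableAt_sandwich_inv (differentiableAt_rootH hreg hG)
    ((hA.fun_sub hA.star).fun_const_smul _) (rootH_posDef hreg.self_of_nhds.H_posDef).isUnit

end L2Operator

theorem hasDerivAt_cayleyValue_branch {θ : ℝ → ℝ} {η : ℂ} {p₀ : ℝ} (hp : p₀ ≠ 0)
    (hreg : ∀ᶠ u in 𝓝 t, Regular n (α u) (τ u) ζ s)
    (hG : ∀ i j, DifferentiableAt ℝ (fun u => G n (α u) (τ u) i j) t)
    (hθ : IsArgBranch (fun u => G n (α u) (τ u)) t η θ) :
    HasDerivAt (fun u => cayleyValue (conj ζ * Complex.exp (θ u * Complex.I)))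
      (quadForm (rootH n (α t) (τ t) ζ s * matrixDeriv (fun u => cayley n (α u) (τ u) ζ s) t *
          rootH n (α t) (τ t) ζ s) (polyVec n (α t) (τ t) ζ s p₀ η) /
        quadForm (H n (α t) (τ t) ζ s) (polyVec n (α t) (τ t) ζ s p₀ η)) t := by
  obtain ⟨hcont, heig, rfl⟩ := hθ
  have hH := hreg.self_of_nhds.H_posDef
  have hz : ContinuousAt (fun u => Complex.exp (θ u * Complex.I)) t :=
    ((Complex.continuous_ofReal.continuousAt.comp hcont.self_of_nhds).mul_const _).cexp
  have hx : ContinuousAt (fun u => rootH n (α u) (τ u) ζ s *ᵥ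
      polyVec n (α u) (τ u) ζ s p₀ (Complex.exp (θ u * Complex.I))) t :=
    (continuous_fst.matrix_mulVec continuous_snd).continuousAt.comp
      ((differentiableAt_rootH hreg hG).continuousAt.prodMk
        (continuousAt_polyVec hreg.self_of_nhds hG hz p₀))
  have hC : ∀ i j, HasDerivAt (fun u => cayley n (α u) (τ u) ζ s i j)
      (matrixDeriv (fun u => cayley n (α u) (τ u) ζ s) t i j) t := fun i j =>
    (differentiableAt_matrix_iff.mp (differentiableAt_cayley hreg hG) i j).hasDerivAt
  have hev : ∀ᶠ u in 𝓝 t, cayley n (α u) (τ u) ζ s *ᵥ (rootH n (α u) (τ u) ζ s *ᵥ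
        polyVec n (α u) (τ u) ζ s p₀ (Complex.exp (θ u * Complex.I))) =
      cayleyValue (conj ζ * Complex.exp (θ u * Complex.I)) • (rootH n (α u) (τ u) ζ s *ᵥ
        polyVec n (α u) (τ u) ζ s p₀ (Complex.exp (θ u * Complex.I))) := by
    filter_upwards [hreg, heig] with u hu heig
    exact hu.cayley_mulVec hp ((hu.isEigenvalue_iff_isRoot_poly hp _).mp heig)
  refine (hasDerivAt_eigenvalue hC (cayley_isHermitian hH) hx
    (rootH_mulVec_ne_zero hH (polyVec_ne_zero hp _)) hev).congr_deriv ?_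
  rw [quadForm_mul_mul (rootH_posDef hH).isHermitian, quadForm_H hH, quadForm]

theorem quadForm_matrixDeriv_cayley {θ : ℝ → ℝ} {η : ℂ} {p₀ : ℝ} (hp : p₀ ≠ 0)
    (hreg : ∀ᶠ u in 𝓝 t, Regular n (α u) (τ u) ζ s)
    (hG : ∀ i j, DifferentiableAt ℝ (fun u => G n (α u) (τ u) i j) t)
    (hθ : IsArgBranch (fun u => G n (α u) (τ u)) t η θ) (hdiff : DifferentiableAt ℝ θ t) :
    quadForm (rootH n (α t) (τ t) ζ s * matrixDeriv (fun u => cayley n (α u) (τ u) ζ s) t *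
        rootH n (α t) (τ t) ζ s) (polyVec n (α t) (τ t) ζ s p₀ η) =
      quadForm (H n (α t) (τ t) ζ s) (polyVec n (α t) (τ t) ζ s p₀ η) /
        ((Real.cos (Complex.arg (conj ζ * η)) - 1 : ℝ) : ℂ) * ((deriv θ t : ℝ) : ℂ) := by
  have hderiv := hasDerivAt_cayleyValue_branch hp hreg hG hθ
  obtain ⟨-, heig, rfl⟩ := hθ
  have hreg := hreg.self_of_nhds
  have hne := hreg.conj_base_mul_ne_one_of_isRoot_poly hp
    ((hreg.isEigenvalue_iff_isRoot_poly hp _).mp heig.self_of_nhds)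
  have hderiv' := hasDerivAt_cayleyValue_exp
    (by rw [Complex.norm_conj, hreg.norm_base]) hdiff.hasDerivAt hne
  have hpos : quadForm (H n (α t) (τ t) ζ s)
      (polyVec n (α t) (τ t) ζ s p₀ (Complex.exp (θ t * Complex.I))) ≠ 0 :=
    (hreg.H_posDef.dotProduct_mulVec_pos (polyVec_ne_zero hp _)).ne'
  rw [(div_eq_iff hpos).mp (hderiv.unique hderiv')]
  exact div_mul_comm ..

end Curve

section Branch

open scoped Matrix.Norms.Elementwise

variable {m : ℕ} {M : ℝ → Matrix (Fin m) (Fin m) ℂ} {t : ℝ} {η : ℂ}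

theorem exists_isArgBranch (hM : ∀ᶠ u in 𝓝 t, ContinuousAt M u) (hη : IsEigenvalue (M t) η)
    (hsimple : (M t).charpoly.derivative.eval η ≠ 0)
    (hnorm : ∀ᶠ u in 𝓝 t, ∀ z, IsEigenvalue (M u) z → ‖z‖ = 1) :
    ∃ θ : ℝ → ℝ, IsArgBranch M t η θ := by
  obtain ⟨φ, hφt, -, hφ, hroot, -⟩ := exists_differentiableAt_isRoot_charpoly
    ((isEigenvalue_iff_isRoot_charpoly _ _).mp hη) hsimple
  have hlim : Tendsto M (𝓝 t) (𝓝 (M t)) := hM.self_of_nhds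
  have heig : ∀ᶠ u in 𝓝 t, IsEigenvalue (M u) (φ (M u)) :=
    (hlim.eventually hroot).mono fun u => (isEigenvalue_iff_isRoot_charpoly _ _).mpr
  obtain ⟨θ, hθ, hexp⟩ := exists_continuousAt_argument (z := fun u => φ (M u))
    ((hM.and (hlim.eventually hφ)).mono fun u hu => hu.2.comp hu.1)
    ((hnorm.and heig).mono fun u hu => hu.1 _ hu.2)
  exact ⟨θ, hθ, (heig.and hexp).mono fun u hu => hu.2 ▸ hu.1, hexp.self_of_nhds.trans hφt⟩

theorem IsArgBranch.differentiableAt {θ : ℝ → ℝ} (hθ : IsArgBranch M t η θ)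
    (hM : DifferentiableAt ℝ M t) (hsimple : (M t).charpoly.derivative.eval η ≠ 0) :
    DifferentiableAt ℝ θ t := by
  obtain ⟨hcont, heig, rfl⟩ := hθ
  obtain ⟨φ, -, hφ, -, -, hunique⟩ := exists_differentiableAt_isRoot_charpoly
    ((isEigenvalue_iff_isRoot_charpoly _ _).mp heig.self_of_nhds) hsimple
  have hz : ContinuousAt (fun u => Complex.exp (θ u * Complex.I)) t :=
    ((Complex.continuous_ofReal.continuousAt.comp hcont.self_of_nhds).mul_const _).cexp
  have hlim : Tendsto (fun u => (M u, Complex.exp (θ u * Complex.I))) (𝓝 t) (𝓝 (M t, _)) :=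
    hM.continuousAt.prodMk hz
  refine differentiableAt_argument hcont.self_of_nhds ((hφ.restrictScalars ℝ).comp t hM) ?_
  filter_upwards [hlim.eventually hunique, heig] with u hu heig
  exact (hu ((isEigenvalue_iff_isRoot_charpoly _ _).mp heig)).symm

end Branch

end Hessenberg

end

theorem mainTheorem1_general (n : ℕ) (α : ℝ → ℕ → ℂ) (τ : ℝ → ℂ) (t : ℝ)
    (hα : ∀ᶠ u in 𝓝 t, ∀ j < n, ‖α u j‖ < 1) (hτ : ∀ᶠ u in 𝓝 t, ‖τ u‖ = 1)
    (hcont : ∀ᶠ u in 𝓝 t, ∀ i j, ContinuousAt (fun v => Hessenberg.G n (α v) (τ v) i j) u)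
    (hG : ∀ i j, DifferentiableAt ℝ (fun u => Hessenberg.G n (α u) (τ u) i j) t)
    (ζ s : ℂ) (hζ : ‖ζ‖ = 1) (hs : s ^ 2 = ζ) (p₀ : ℝ) (hp₀ : p₀ ≠ 0)
    (ht : ¬ Hessenberg.IsEigenvalue (Hessenberg.G n (α t) (τ t)) ζ) :
    (Hessenberg.H n (α t) (τ t) ζ s).PosDef ∧
    (∀ z : ℂ, Hessenberg.IsEigenvalue (Hessenberg.G n (α t) (τ t)) z ↔
      (Hessenberg.poly n (α t) (τ t) ζ s p₀ (n + 1)).IsRoot z) ∧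
    (Hessenberg.poly n (α t) (τ t) ζ s p₀ (n + 1)).roots =
      (Hessenberg.G n (α t) (τ t)).charpoly.roots ∧
    (∀ i j, DifferentiableAt ℝ (fun u => Hessenberg.cayley n (α u) (τ u) ζ s i j) t) ∧
    ∀ η : ℂ, Hessenberg.IsEigenvalue (Hessenberg.G n (α t) (τ t)) η →
      (∃ θ : ℝ → ℝ, Hessenberg.IsArgBranch (fun u => Hessenberg.G n (α u) (τ u)) t η θ) ∧
      ∀ θ : ℝ → ℝ, Hessenberg.IsArgBranch (fun u => Hessenberg.G n (α u) (τ u)) t η θ →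
        DifferentiableAt ℝ θ t ∧
        Hessenberg.quadForm
            (Hessenberg.rootH n (α t) (τ t) ζ s
              * Hessenberg.matrixDeriv (fun u => Hessenberg.cayley n (α u) (τ u) ζ s) t
              * Hessenberg.rootH n (α t) (τ t) ζ s)
            (Hessenberg.polyVec n (α t) (τ t) ζ s p₀ η) =
          Hessenberg.quadForm (Hessenberg.H n (α t) (τ t) ζ s)
              (Hessenberg.polyVec n (α t) (τ t) ζ s p₀ η)
            / ((Real.cos (Complex.arg (conj ζ * η)) - 1 : ℝ) : ℂ)
            * ((deriv θ t : ℝ) : ℂ) := by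
  have hreg : ∀ᶠ u in 𝓝 t, Hessenberg.Regular n (α u) (τ u) ζ s :=
    Hessenberg.eventually_regular
      ((hα.and hτ).mono fun u hu => ⟨hu.1, hu.2, hζ, hs⟩) hG ht
  have hregular := hreg.self_of_nhds
  refine ⟨hregular.H_posDef, hregular.isEigenvalue_iff_isRoot_poly hp₀,
    hregular.roots_poly_eq_roots_charpoly hp₀, ?_, fun η hη => ⟨?_, fun θ hθ => ?_⟩⟩
  · exact Hessenberg.differentiableAt_matrix_iff.mp (Hessenberg.differentiableAt_cayley hreg hG)
  · exact Hessenberg.exists_isArgBranch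
      (hcont.mono fun u hu => continuousAt_pi.mpr fun i => continuousAt_pi.mpr (hu i)) hη
      (hregular.eval_derivative_charpoly_ne_zero hη)
      (hreg.mono fun u hu z => hu.norm_eq_one_of_isEigenvalue)
  · have hdiff := hθ.differentiableAt (Hessenberg.differentiableAt_matrix_iff.mpr hG)
      (hregular.eval_derivative_charpoly_ne_zero hη)
    exact ⟨hdiff, Hessenberg.quadForm_matrixDeriv_cayley hp₀ hreg hG hθ hdiff⟩

theorem mainTheorem1 (n : ℕ) (α : ℝ → ℕ → ℂ) (τ : ℝ → ℂ)
    (hα : ∀ t, ∀ j < n, ‖α t j‖ < 1) (hτ : ∀ t, ‖τ t‖ = 1)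
    (hG : ∀ i j, Differentiable ℝ fun t => Hessenberg.G n (α t) (τ t) i j)
    (ζ s : ℂ) (hζ : ‖ζ‖ = 1) (hs : s ^ 2 = ζ) (p₀ : ℝ) (hp₀ : p₀ ≠ 0)
    (t : ℝ) (ht : ¬ Hessenberg.IsEigenvalue (Hessenberg.G n (α t) (τ t)) ζ) :
    (Hessenberg.H n (α t) (τ t) ζ s).PosDef ∧
    (∀ z : ℂ, Hessenberg.IsEigenvalue (Hessenberg.G n (α t) (τ t)) z ↔
      (Hessenberg.poly n (α t) (τ t) ζ s p₀ (n + 1)).IsRoot z) ∧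
    (Hessenberg.poly n (α t) (τ t) ζ s p₀ (n + 1)).roots =
      (Hessenberg.G n (α t) (τ t)).charpoly.roots ∧
    (∀ i j, DifferentiableAt ℝ (fun u => Hessenberg.cayley n (α u) (τ u) ζ s i j) t) ∧
    ∀ η : ℂ, Hessenberg.IsEigenvalue (Hessenberg.G n (α t) (τ t)) η →
      (∃ θ : ℝ → ℝ, Hessenberg.IsArgBranch (fun u => Hessenberg.G n (α u) (τ u)) t η θ) ∧
      ∀ θ : ℝ → ℝ, Hessenberg.IsArgBranch (fun u => Hessenberg.G n (α u) (τ u)) t η θ →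
        DifferentiableAt ℝ θ t ∧
        Hessenberg.quadForm
            (Hessenberg.rootH n (α t) (τ t) ζ s
              * Hessenberg.matrixDeriv (fun u => Hessenberg.cayley n (α u) (τ u) ζ s) t
              * Hessenberg.rootH n (α t) (τ t) ζ s)
            (Hessenberg.polyVec n (α t) (τ t) ζ s p₀ η) =
          Hessenberg.quadForm (Hessenberg.H n (α t) (τ t) ζ s)
              (Hessenberg.polyVec n (α t) (τ t) ζ s p₀ η)
            / ((Real.cos (Complex.arg (conj ζ * η)) - 1 : ℝ) : ℂ)
            * ((deriv θ t : ℝ) : ℂ) := by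
  exact mainTheorem1_general n α τ t (.of_forall hα) (.of_forall hτ)
    (.of_forall fun u i j => (hG i j u).continuousAt) (fun i j => hG i j t) ζ s hζ hs p₀ hp₀ ht
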